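/- For a simple graph $G$ on $n$ vertices with Laplacian matrix $L(G)=D(G)-A(G)$, define the Laplacian coefficients $c_0(G),\dots,c_n(G)$ by $\det(\lambda I_n-L(G))=\sum_{k=0}^n(-1)^kc_k(G)\lambda^{n-k}$. For graphs $G,H$ of order $n$ write $G\preceq H$ if $c_k(G)\le c_k(H)$ for all $0\le k\le n$, and $G\prec H$ if moreover $c_k(G)<c_k(H)$ for some $k$. For $l\ge 1$ let $\mathcal U_{n,l}^{4}$ be the set of all $n$-vertex unicyclic graphs (connected, with $n$ edges) with exactly $l$ leaves (vertices of degree one) and girth $4$; it is called a poset under $\preceq$ (graphs being considered up to isomorphism), and $G\in\mathcal U_{n,l}^4$ is minimal if there is no $H\in\mathcal U_{n,l}^4$ with $H\prec G$. Let $BST_{m,l}$ be the balanced starlike tree of order $m$: $l$ paths, each of order $\lfloor\frac{m-1}{l}\rfloor+1$ or $\lceil\frac{m-1}{l}\rceil+1$, identified at one common end, the center (so that the total order is $m$). For $p\ge 0$ with $n\ge 4+p+l$ let $U_{n,l}^{4,p}$ be the $n$-vertex graph obtained from a path with $p+1$ vertices by identifying one of its ends with a vertex of a cycle of order $4$, and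 its other end with the center of $BST_{n-p-3,l}$ (for $p=0$ the two ends coincide). Theorem 4.6. Let $l\ge 1$, $n\ge l+4$ and $p=\max\{0,\lfloor\frac{n-4-3l}{l+1}\rfloor\}$. Then the minimal elements of $(\mathcal U_{n,l}^4,\preceq)$ are, up to isomorphism, exactly $U_{n,l}^{4,0},U_{n,l}^{4,1},\dots,U_{n,l}^{4,p}$. If $l\ge 2$, these $p+1$ graphs are pairwise non-isomorphic and pairwise incomparable with respect to $\preceq$, so that there are exactly $p+1$ minimal elements. -/

import Mathlib

namespace LaplacianPoset

open Classical in
/-- The Laplacian coefficient `c_k(G)`, determined by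
`det (λ I - L(G)) = ∑_{k=0}^{n} (-1)^k c_k(G) λ^{n-k}` with `n` the number of vertices
(meaningful for `k ≤ n`). -/
noncomputable def laplacianCoeff {V : Type*} [Fintype V] (G : SimpleGraph V) (k : ℕ) : ℝ :=
  (-1) ^ k * (G.lapMatrix ℝ).charpoly.coeff (Fintype.card V - k)

/-- `G ≼ H`, for two graphs of the same order `n`: `c_k(G) ≤ c_k(H)` for all `0 ≤ k ≤ n`. -/
def LapLE {V W : Type*} [Fintype V] [Fintype W] (G : SimpleGraph V) (H : SimpleGraph W) : Prop :=
  Fintype.card V = Fintype.card W ∧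
    ∀ k ≤ Fintype.card V, laplacianCoeff G k ≤ laplacianCoeff H k

/-- `G ≺ H`: `G ≼ H`, and `c_k(G) < c_k(H)` for some `0 ≤ k ≤ n`. -/
def LapLT {V W : Type*} [Fintype V] [Fintype W] (G : SimpleGraph V) (H : SimpleGraph W) : Prop :=
  LapLE G H ∧ ∃ k ≤ Fintype.card V, laplacianCoeff G k < laplacianCoeff H k

open Classical in
/-- The `n`-vertex unicyclic graphs (connected graphs with as many edges as vertices) with exactly
`l` leaves (vertices of degree one) and girth `g`, as graphs on the vertex set `Fin n`. -/
def unicyclicGraphs (n l g : ℕ) : Set (SimpleGraph (Fin n)) :=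
  {G | G.Connected ∧ G.edgeSet.ncard = n ∧ {v | G.degree v = 1}.ncard = l ∧ G.girth = g}

/-- `G` is a minimal element of the family `S` of graphs with respect to `≼`:
no member of `S` is strictly below it. -/
def IsMinimalElement {n : ℕ} (S : Set (SimpleGraph (Fin n))) (G : SimpleGraph (Fin n)) : Prop :=
  G ∈ S ∧ ∀ H ∈ S, ¬ LapLT H G

/-- The starlike tree obtained from paths of orders `a j + 1` (`j : Fin l`) by identifying one end
of each of them. The vertex `none` is the common end (the center); `some ⟨j, i⟩` is the vertex at
distance `i + 1` from the center on the `j`-th path. -/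
def starlikeTree {l : ℕ} (a : Fin l → ℕ) : SimpleGraph (Option (Σ j : Fin l, Fin (a j))) :=
  SimpleGraph.fromRel fun x y =>
    match x, y with
    | none, some v => v.2.val = 0
    | some u, some v => u.1 = v.1 ∧ u.2.val + 1 = v.2.val
    | _, none => False

/-- The lengths of the `l` paths of the balanced starlike tree of order `n`: each of them is
`⌊(n-1)/l⌋` or `⌈(n-1)/l⌉`, and their sum is `n - 1`. -/
def balancedLength (n l : ℕ) (j : Fin l) : ℕ :=
  (n - 1) / l + if j.val < (n - 1) % l then 1 else 0

/-- The vertices of the balanced starlike tree `BST_{n,l}`. -/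
abbrev BSTVertex (n l : ℕ) : Type := Option (Σ j : Fin l, Fin (balancedLength n l j))

/-- The balanced starlike tree `BST_{n,l}` of order `n` with `l` leaves (`1 ≤ l < n`); its center
is the vertex `none`. -/
def BST (n l : ℕ) : SimpleGraph (BSTVertex n l) := starlikeTree (balancedLength n l)

/-- The vertices of the disjoint union of two graphs after identifying one vertex of the first one
with the vertex `w` of the second one. -/
abbrev GlueVertex (V : Type*) {W : Type*} (w : W) := V ⊕ {x : W // x ≠ w}

/-- The graph obtained from the disjoint union of `G` and `H` by identifying the vertex `v` of `G`
with the vertex `w` of `H`; the merged vertex is `Sum.inl v`. -/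
def glue {V W : Type*} (G : SimpleGraph V) (v : V) (H : SimpleGraph W) (w : W) :
    SimpleGraph (GlueVertex V w) where
  Adj x y :=
    match x, y with
    | .inl a, .inl b => G.Adj a b
    | .inl a, .inr y => a = v ∧ H.Adj w y
    | .inr x, .inl b => b = v ∧ H.Adj w x
    | .inr x, .inr y => H.Adj x y
  symm := ⟨fun x y h => by
    rcases x with a | x <;> rcases y with b | y
    · exact SimpleGraph.Adj.symm h
    · exact h
    · exact h
    · exact SimpleGraph.Adj.symm h⟩
  loopless := ⟨fun x h => by
    rcases x with a | x
    · exact G.irrefl h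
    · exact H.irrefl h⟩

/-- The vertex of `glue G v H w` that comes from the vertex `x` of `H`. -/
def glueInr {V W : Type*} [DecidableEq W] (v : V) (w : W) (x : W) : GlueVertex V w :=
  if h : x = w then .inl v else .inr ⟨x, h⟩

/-- The vertices of the balanced starlike unicyclic graph `U_{n,l}^{g,p}`. -/
abbrev UVertex (n l g p : ℕ) : Type :=
  GlueVertex (GlueVertex (Fin g) (0 : Fin (p + 1))) (none : BSTVertex (n - p - g + 1) l)

/-- The balanced starlike unicyclic graph `U_{n,l}^{g,p}` of order `n` with `l` leaves and girth
`g` (for `g ≥ 3`, `l ≥ 1`, `n ≥ g + p + l`): one end of a path of order `p + 1` is identified with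
a vertex of a cycle of order `g`, and the other end of the path is identified with the center of
the balanced starlike tree `BST_{n-p-g+1,l}`. -/
def U (n l g p : ℕ) [NeZero g] : SimpleGraph (UVertex n l g p) :=
  glue (glue (SimpleGraph.cycleGraph g) 0 (SimpleGraph.pathGraph (p + 1)) 0)
    (glueInr 0 0 (Fin.last p)) (BST (n - p - g + 1) l) none

end LaplacianPoset

/-!
The Laplacian coefficients of a graph are the coefficients of `P = det (1 + t L)`, so graphs are
compared by asking whether a difference of two such polynomials has nonnegative coefficients. For a
rooted graph let `Q` be the principal minor of `1 + t L` at the root, and `R = P - Q`. Identifying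
two roots multiplies `Q` and acts on `R` like a product rule (`Q_mul`, `R_mul`), and joining a new
root to the old one acts on `(Q, R)` linearly (`Q_ext`, `R_ext`). Isomorphism classes of rooted
graphs form a commutative monoid with an operation `ext`, rooted trees are what is generated by
these operations, and a unicyclic graph of girth four is a cycle with four rooted trees attached
(`mem_unicyclicGraphs_iff`). All comparisons thus become polynomial identities in `Q` and `R`.

*Minimal graphs are balanced starlike.* Let `D a b = Q_b R_a - Q_a R_b`, and call `a` heavier than
`b` if `D a b` has nonnegative coefficients; for instance longer paths are heavier than shorter ones
(`D_path_path`). Branches can be moved towards the heavier part of a tree, and an edge can be moved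
from a heavier to a lighter branch, without increasing any coefficient (`reducible_of_heavier_root`,
`reducible_of_heavier_branch`, `reducible_ext_mul`). It follows that a tree that cannot be improved
has one branching vertex with legs of almost equal length (`TreeClass.exists_bouquet`,
`reducible_bouquet`). Trees attached to different vertices of the cycle can be merged
(`exists_eq_squareRoot_mul`). So a minimal graph consists of the cycle, a path with `i` edges and a
balanced bouquet of legs. If an edge is moved from a path with `i + 1` edges to a leg `p`, and `x`
is the bouquet of the other legs, then `P` decreases by `R_x * D (ext^[i] squareRoot) p`
(`P_sub_P`); here `ext^[i] squareRoot`, the cycle with a path of `i` edges, is heavier than the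
paths with at most `i + 3` edges (`pos_D_iterate_squareRoot`). Hence all legs have at least `i + 3`
edges if `0 < i` (`exists_eq_bouquet`), which is the condition `i ≤ p`.

*All candidates are minimal.* The same formula compares consecutive candidates. The rooted cycle is
incomparable to the paths with at least four edges: the sign of `D` differs at `t = 1 / 10` and
`t = 100`. Therefore the values of `P` at these two arguments are monotone in opposite directions
along the sequence of candidates (`eval_P_starlike`), which makes them pairwise incomparable for at
least two leaves; for a single leaf they all have the same Laplacian coefficients
(`P_starlike_one`). Since every graph that can be improved lies above one that cannot be improved,
by finiteness, and the latter is a candidate, no candidate can be improved.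
-/

namespace LaplacianPoset

open SimpleGraph Polynomial

/-! ### Isomorphisms between glued graphs -/

section GlueIso

variable {V V' W W' Z : Type*}

/-- Gluing respects isomorphisms of rooted graphs. -/
def glueCongr {G : SimpleGraph V} {G' : SimpleGraph V'} {H : SimpleGraph W} {H' : SimpleGraph W'}
    (φ : G ≃g G') (ψ : H ≃g H') {v : V} {v' : V'} {w : W} {w' : W'}
    (hv : φ v = v') (hw : ψ w = w') : glue G v H w ≃g glue G' v' H' w' where
  toEquiv := Equiv.sumCongr φ.toEquiv (ψ.toEquiv.subtypeEquiv fun x => by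
    subst hw; exact (not_congr ψ.toEquiv.injective.eq_iff).symm)
  map_rel_iff' := by
    subst hv hw
    rintro (a | a) (b | b)
    · exact φ.map_adj_iff
    · exact and_congr φ.injective.eq_iff ψ.map_adj_iff
    · exact and_congr φ.injective.eq_iff ψ.map_adj_iff
    · exact ψ.map_adj_iff

/-- Two graphs can be glued onto a third one in either order. -/
def glueGlueComm (G : SimpleGraph V) (v u : V) (H : SimpleGraph W) (w : W) (K : SimpleGraph Z)
    (z : Z) :
    glue (glue G v H w) (.inl u) K z ≃g glue (glue G u K z) (.inl v) H w where
  toFun x := match x with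
    | .inl (.inl a) => .inl (.inl a)
    | .inl (.inr b) => .inr b
    | .inr c => .inl (.inr c)
  invFun x := match x with
    | .inl (.inl a) => .inl (.inl a)
    | .inl (.inr b) => .inr b
    | .inr c => .inl (.inr c)
  left_inv := by rintro ((a | b) | c) <;> rfl
  right_inv := by rintro ((a | b) | c) <;> rfl
  map_rel_iff' := by
    rintro ((a | b) | c) ((a' | b') | c') <;> simp [glue]

open Classical in
/-- Gluing is symmetric in the two graphs. -/
noncomputable def glueSwap (G : SimpleGraph V) (v : V) (H : SimpleGraph W) (w : W) :
    glue G v H w ≃g glue H w G v where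
  toFun x := match x with
    | .inl a => if h : a = v then .inl w else .inr ⟨a, h⟩
    | .inr b => .inl b
  invFun x := match x with
    | .inl a => if h : a = w then .inl v else .inr ⟨a, h⟩
    | .inr b => .inl b
  left_inv := by
    rintro (a | ⟨b, hb⟩)
    · by_cases h : a = v <;> simp [h]
    · simp [hb]
  right_inv := by
    rintro (a | ⟨b, hb⟩)
    · by_cases h : a = w <;> simp [h]
    · simp [hb]
  map_rel_iff' := by
    rintro (a | ⟨b, hb⟩) (a' | ⟨b', hb'⟩)
    · by_cases h : a = v <;> by_cases h' : a' = v <;> simp [h, h', glue, G.adj_comm]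
    · by_cases h : a = v <;> simp [h, hb', glue]
    · by_cases h : a' = v <;> simp [h, hb, glue, H.adj_comm]
    · simp [glue]

open Classical in
/-- Gluing is associative: `K` is glued to a vertex `x` of `H`, before or after `H` is glued
to `G`. -/
noncomputable def glueAssoc (G : SimpleGraph V) (v : V) (H : SimpleGraph W) (w x : W)
    (K : SimpleGraph Z) (z : Z) :
    glue G v (glue H x K z) (.inl w) ≃g glue (glue G v H w) (glueInr v w x) K z where
  toFun y := match y with
    | .inl a => .inl (.inl a)
    | .inr ⟨.inl b, hb⟩ => .inl (.inr ⟨b, fun h => hb (h ▸ rfl)⟩)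
    | .inr ⟨.inr c, _⟩ => .inr c
  invFun y := match y with
    | .inl (.inl a) => .inl a
    | .inl (.inr b) => .inr ⟨.inl b.1, fun h => b.2 (Sum.inl_injective h)⟩
    | .inr c => .inr ⟨.inr c, Sum.inr_ne_inl⟩
  left_inv := by rintro (a | ⟨b | c, hb⟩) <;> rfl
  right_inv := by rintro ((a | b) | c) <;> rfl
  map_rel_iff' := by
    rintro (a | ⟨b | c, hb⟩) (a' | ⟨b' | c', hb'⟩)
    · simp [glue]
    · simp [glue]
    · by_cases h : x = w
      · subst h; simp [glue, glueInr]
      · simp [glue, glueInr, h, Ne.symm h]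
    · simp [glue]
    · simp [glue]
    · by_cases h : x = w
      · subst h; simp [glue, glueInr]; rintro rfl; exact absurd rfl hb
      · simp [glue, glueInr, h]
    · by_cases h : x = w
      · subst h; simp [glue, glueInr]
      · simp [glue, glueInr, h, Ne.symm h]
    · by_cases h : x = w
      · subst h; simp [glue, glueInr]; rintro rfl; exact absurd rfl hb'
      · simp [glue, glueInr, h]
    · simp [glue]

/-- Gluing a one-vertex graph changes nothing. -/
def glueUnit (G : SimpleGraph V) (v : V) [Subsingleton W] (H : SimpleGraph W) (w : W) :
    glue G v H w ≃g G where
  toFun x := match x with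
    | .inl a => a
    | .inr b => (b.2 (Subsingleton.elim _ _)).elim
  invFun := .inl
  left_inv := by
    rintro (a | b)
    · rfl
    · exact (b.2 (Subsingleton.elim _ _)).elim
  right_inv _ := rfl
  map_rel_iff' := by
    rintro (a | b) (a' | b')
    · rfl
    · exact (b'.2 (Subsingleton.elim _ _)).elim
    · exact (b.2 (Subsingleton.elim _ _)).elim
    · exact (b.2 (Subsingleton.elim _ _)).elim

end GlueIso

/-! ### Isomorphism classes of framed graphs -/

/-- A finite graph with marked vertices, indexed by `I` and not required to be distinct. For
`I = Unit` this is a rooted graph, for `I = Empty` a plain graph. -/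
structure FramedGraph (I : Type) where
  V : Type
  [fintype : Fintype V]
  graph : SimpleGraph V
  pt : I → V

attribute [instance] FramedGraph.fintype

instance FramedGraph.setoid (I : Type) : Setoid (FramedGraph I) where
  r F F' := ∃ φ : F.graph ≃g F'.graph, ∀ i, φ (F.pt i) = F'.pt i
  iseqv :=
    { refl := fun _ => ⟨Iso.refl, fun _ => rfl⟩
      symm := fun ⟨φ, h⟩ => ⟨φ.symm, fun i => by rw [← h i]; exact φ.symm_apply_apply _⟩
      trans := fun ⟨φ, h⟩ ⟨ψ, k⟩ => ⟨φ.trans ψ, fun i => by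
        rw [← k i, ← h i]; rfl⟩ }

/-- Isomorphism classes of framed graphs, the isomorphisms respecting the marks. -/
def FramedClass (I : Type) : Type 1 := Quotient (FramedGraph.setoid I)

variable {I J : Type}

namespace FramedGraph

/-- The isomorphism class of a framed graph. -/
def cls (F : FramedGraph I) : FramedClass I := Quotient.mk _ F

theorem cls_eq {F F' : FramedGraph I} :
    F.cls = F'.cls ↔ ∃ φ : F.graph ≃g F'.graph, ∀ i, φ (F.pt i) = F'.pt i := Quotient.eq

open Classical in
/-- Glue the root of `A` to the marked vertex `i` of `F`. -/
noncomputable def attach (F : FramedGraph I) (i : I) (A : FramedGraph Unit) : FramedGraph I where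
  V := GlueVertex F.V (A.pt ())
  graph := glue F.graph (F.pt i) A.graph (A.pt ())
  pt j := .inl (F.pt j)

/-- Change the marking: the new mark `j` is the old mark `σ j`. -/
def reframe (F : FramedGraph I) (σ : J → I) : FramedGraph J := ⟨F.V, F.graph, F.pt ∘ σ⟩

/-- The single vertex. -/
def single : FramedGraph Unit := ⟨Unit, ⊥, id⟩

/-- The single edge, with both ends marked. -/
def link : FramedGraph (Fin 2) := ⟨Fin 2, ⊤, id⟩

/-- The cycle of order four, all of whose vertices are marked. -/
def square : FramedGraph (Fin 4) := ⟨Fin 4, cycleGraph 4, id⟩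

/-- Add a new vertex, joined to the vertex `y` only. -/
noncomputable def graft (F : FramedGraph I) (y : F.V) : FramedGraph I where
  V := GlueVertex F.V (0 : Fin 2)
  graph := glue F.graph y (⊤ : SimpleGraph (Fin 2)) 0
  pt j := .inl (F.pt j)

end FramedGraph

namespace FramedClass

open FramedGraph

theorem ind {p : FramedClass I → Prop} (h : ∀ F : FramedGraph I, p F.cls) (c) : p c :=
  Quotient.ind h c

/-- Glue the root of `a` to the marked vertex `i` of `c`; the marks of `c` are kept. -/
noncomputable def attach (c : FramedClass I) (i : I) (a : FramedClass Unit) : FramedClass I :=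
  Quotient.map₂ (fun F A => FramedGraph.attach F i A)
    (by
      rintro _ _ ⟨φ, h⟩ _ _ ⟨ψ, k⟩
      exact ⟨glueCongr φ ψ (h i) (k ()), fun j => congrArg Sum.inl (h j)⟩) c a

/-- Change the marking: the new mark `j` is the old mark `σ j`. -/
def reframe (c : FramedClass I) (σ : J → I) : FramedClass J :=
  Quotient.map (fun F => FramedGraph.reframe F σ)
    (by rintro _ _ ⟨φ, h⟩; exact ⟨φ, fun j => h (σ j)⟩) c

theorem attach_cls (F : FramedGraph I) (i : I) (A : FramedGraph Unit) :
    attach F.cls i A.cls = (F.attach i A).cls := rfl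

theorem reframe_cls (F : FramedGraph I) (σ : J → I) :
    reframe F.cls σ = (F.reframe σ).cls := rfl

theorem attach_comm (c : FramedClass I) (i j : I) (a b : FramedClass Unit) :
    (c.attach i a).attach j b = (c.attach j b).attach i a := by
  induction c using ind with | _ F
  induction a using ind with | _ A
  induction b using ind with | _ B
  exact cls_eq.2 ⟨glueGlueComm _ _ _ _ _ _ _, fun _ => rfl⟩

/-- The single vertex is neutral for the identification of roots. -/
noncomputable instance : One (FramedClass Unit) := ⟨single.cls⟩

/-- The product of two rooted graphs identifies their roots. -/
noncomputable instance : Mul (FramedClass Unit) := ⟨fun a b => a.attach () b⟩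

theorem one_def : (1 : FramedClass Unit) = single.cls := rfl

theorem attach_one (c : FramedClass I) (i : I) : c.attach i 1 = c := by
  induction c using ind with | _ F
  exact cls_eq.2 ⟨@glueUnit _ _ _ _ (inferInstanceAs (Subsingleton Unit)) _ _, fun _ => rfl⟩

theorem attach_attach (c : FramedClass I) (i : I) (a b : FramedClass Unit) :
    (c.attach i a).attach i b = c.attach i (a * b) := by
  induction c using ind with | _ F
  induction a using ind with | _ A
  induction b using ind with | _ B
  refine (cls_eq.2 ⟨(glueAssoc F.graph (F.pt i) A.graph (A.pt ()) (A.pt ()) B.graph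
    (B.pt ())).trans (glueCongr Iso.refl Iso.refl ?_ rfl), fun _ => rfl⟩).symm
  simp [glueInr, FramedGraph.attach]

theorem mul_comm' (a b : FramedClass Unit) : a * b = b * a := by
  induction a using ind with | _ A
  induction b using ind with | _ B
  exact cls_eq.2 ⟨glueSwap _ _ _ _, fun _ => dif_pos rfl⟩

noncomputable instance : CommMonoid (FramedClass Unit) where
  mul_comm := mul_comm'
  mul_assoc a b c := attach_attach a () b c
  mul_one a := attach_one a ()
  one_mul a := (mul_comm' 1 a).trans (attach_one a ())

theorem reframe_attach (c : FramedClass I) (σ : J → I) (j : J) (a : FramedClass Unit) :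
    (c.attach (σ j) a).reframe σ = (c.reframe σ).attach j a := by
  induction c using ind with | _ F
  induction a using ind with | _ A
  rfl

theorem reframe_reframe {K : Type} (c : FramedClass I) (σ : J → I) (τ : K → J) :
    (c.reframe σ).reframe τ = c.reframe (σ ∘ τ) := by
  induction c using ind with | _ F
  rfl

/-- Join a new root to the old root by an edge. -/
noncomputable def ext (a : FramedClass Unit) : FramedClass Unit :=
  (link.cls.attach 1 a).reframe fun _ => 0

/-- The path with `k` edges, rooted at one end. -/
noncomputable def path (k : ℕ) : FramedClass Unit := ext^[k] 1

/-- The underlying class of graphs without marked vertices. -/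
def bare (c : FramedClass I) : FramedClass Empty := c.reframe Empty.elim

theorem bare_reframe (c : FramedClass I) (σ : J → I) : (c.reframe σ).bare = c.bare := by
  unfold bare
  rw [reframe_reframe]
  congr 1
  ext x
  exact x.elim

/-- The cycle of order four, rooted at one of its vertices. -/
noncomputable def squareRoot : FramedClass Unit := square.cls.reframe fun _ => 0

end FramedClass

/-! ### Determinants of glued matrices -/

section GlueMatrix

variable {V W R : Type*} [Fintype V] [DecidableEq V] [Fintype W] [DecidableEq W] [CommRing R]

/-- The principal minor of `A` at `v` (row and column `v` deleted), written as the determinant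
of `A` with row `v` replaced by a unit vector. -/
def pointMinor (A : Matrix V V R) (v : V) : R := (A.updateRow v (Pi.single v 1)).det

/-- Row `v` is multiplied by `q`, and then `r` is added to its diagonal entry. -/
def scaleRow (A : Matrix V V R) (v : V) (q r : R) : Matrix V V R :=
  A.updateRow v (q • A v + r • Pi.single v 1)

theorem det_scaleRow (A : Matrix V V R) (v : V) (q r : R) :
    (scaleRow A v q r).det = q * A.det + r * pointMinor A v := by
  rw [scaleRow, Matrix.det_updateRow_add, Matrix.det_updateRow_smul, Matrix.det_updateRow_smul,
    Matrix.updateRow_eq_self, pointMinor]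

theorem det_submatrix_ne (A : Matrix V V R) (v : V) :
    (A.submatrix Subtype.val Subtype.val : Matrix {x // x ≠ v} {x // x ≠ v} R).det =
      pointMinor A v := by
  rw [pointMinor, Matrix.twoBlockTriangular_det' _ (fun x => x = v)]
  · have h1 : ∀ (_ : Fintype {x // x = v}) (_ : DecidableEq {x // x = v}),
        ((A.updateRow v (Pi.single v 1)).toSquareBlockProp fun i => i = v).det = 1 := by
      let _ : Unique {x // x = v} := Unique.subtypeEq v
      intro _ _
      rw [Matrix.det_unique]
      have h := (default : {x // x = v}).2
      simp [Matrix.toSquareBlockProp, h]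
    have key : ∀ x y z : R, x = 1 → z = y → z = x * y := by rintro _ y _ rfl rfl; simp
    refine key _ _ _ (h1 _ _) ?_
    congr 1
    ext ⟨i, hi⟩ ⟨j, hj⟩
    simp [Matrix.toSquareBlockProp, Matrix.updateRow_ne hi]
  · rintro i rfl j hj
    simp [hj]

/-- The matrix `1 + t L` of a glued graph, in terms of the matrices `A` and `B` of its parts. In the
diagonal entry of the merged vertex the two degrees add up, but the summand `1` occurs only once. -/
def glueMat (A : Matrix V V R) (v : V) (B : Matrix W W R) (w : W) :
    Matrix (GlueVertex V w) (GlueVertex V w) R :=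
  Matrix.fromBlocks (A + (B w w - 1) • Matrix.single v v 1)
    (Matrix.of fun a y => if a = v then B w y else 0)
    (Matrix.of fun x b => if b = v then B x w else 0)
    (B.submatrix Subtype.val Subtype.val)

/-- Gluing is bilinear: the row of the merged vertex is the sum `r₁ + r₂` of a row supported on the
first graph and a row supported on the second one, and either choice makes the matrix block
triangular. -/
theorem det_glueMat (A : Matrix V V R) (v : V) (B : Matrix W W R) (w : W) :
    (glueMat A v B w).det =
      pointMinor B w * A.det + (B.det - pointMinor B w) * pointMinor A v := by
  set r₁ : GlueVertex V w → R := Sum.elim (A v) 0 with hr₁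
  set r₂ : GlueVertex V w → R :=
    Sum.elim ((B w w - 1) • Pi.single v 1) (fun y => B w y) with hr₂
  have hrow : glueMat A v B w = (glueMat A v B w).updateRow (.inl v) (r₁ + r₂) := by
    conv_lhs => rw [← Matrix.updateRow_eq_self (glueMat A v B w) (.inl v)]
    congr 1
    ext (a | y)
    · by_cases h : a = v
      · subst h; simp [glueMat, hr₁, hr₂]
      · simp [glueMat, hr₁, hr₂, h, Matrix.single_apply_of_ne, Ne.symm h]
    · simp [glueMat, hr₁, hr₂]
  have h1 : ((glueMat A v B w).updateRow (.inl v) r₁).det = pointMinor B w * A.det := by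
    have : (glueMat A v B w).updateRow (.inl v) r₁ = Matrix.fromBlocks A 0
        (Matrix.of fun (x : {x : W // x ≠ w}) b => if b = v then B x w else 0)
        (B.submatrix Subtype.val Subtype.val) := by
      ext (a | x) (b | y)
      · by_cases h : a = v
        · subst h; simp [hr₁]
        · simp [Matrix.updateRow_apply, h, glueMat, Ne.symm h]
      · by_cases h : a = v
        · subst h; simp [hr₁]
        · simp [Matrix.updateRow_apply, h, glueMat]
      · simp [Matrix.updateRow_apply, glueMat]
      · simp [Matrix.updateRow_apply, glueMat]
    rw [this, Matrix.det_fromBlocks_zero₁₂, det_submatrix_ne, mul_comm]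
  have h2 : ((glueMat A v B w).updateRow (.inl v) r₂).det =
      (B.det - pointMinor B w) * pointMinor A v := by
    let e : GlueVertex W v ≃ GlueVertex V w := (glueSwap (⊥ : SimpleGraph W) w ⊥ v).toEquiv
    have e1 : e (.inl w) = .inl v := dif_pos rfl
    have e2 : ∀ y (h : y ≠ w), e (.inl y) = .inr ⟨y, h⟩ := fun y h => dif_neg h
    have e3 : ∀ a, e (.inr a) = .inl a.1 := fun a => rfl
    have : ((glueMat A v B w).updateRow (.inl v) r₂).submatrix e e = Matrix.fromBlocks
        (B.updateRow w (B w - Pi.single w 1)) 0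
        (Matrix.of fun (x : {x : V // x ≠ v}) b => glueMat A v B w (.inl x) (e (.inl b)))
        (A.submatrix Subtype.val Subtype.val) := by
      ext (y | ⟨a, ha⟩) (z | ⟨b, hb⟩)
      · by_cases h : y = w
        · subst h
          by_cases h' : z = y
          · subst h'; simp [hr₂, e1]
          · simp [hr₂, e1, e2 z h', h']
        · by_cases h' : z = w
          · subst h'; simp [Matrix.updateRow_apply, e1, e2 y h, glueMat, h]
          · simp [Matrix.updateRow_apply, e2 y h, e2 z h', glueMat, h]
      · by_cases h : y = w
        · subst h
          simp [hr₂, e1, e3, hb]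
        · simp [Matrix.updateRow_apply, e2 y h, e3, glueMat, hb]
      · simp [Matrix.updateRow_apply, e3, ha]
      · simp [Matrix.updateRow_apply, e3, ha, glueMat, Ne.symm ha]
    rw [← Matrix.det_submatrix_equiv_self e, this, Matrix.det_fromBlocks_zero₁₂, det_submatrix_ne,
      sub_eq_add_neg, Matrix.det_updateRow_add, Matrix.updateRow_eq_self,
      ← neg_one_smul R, Matrix.det_updateRow_smul]
    simp only [pointMinor]
    ring1
  rw [hrow, Matrix.det_updateRow_add, h1, h2]

theorem pointMinor_glueMat_self (A : Matrix V V R) (v : V) (B : Matrix W W R) (w : W) :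
    pointMinor (glueMat A v B w) (.inl v) = pointMinor A v * pointMinor B w := by
  have : (glueMat A v B w).updateRow (.inl v) (Pi.single (.inl v) 1) =
      Matrix.fromBlocks (A.updateRow v (Pi.single v 1)) 0
        (Matrix.of fun (x : {x : W // x ≠ w}) b => if b = v then B x w else 0)
        (B.submatrix Subtype.val Subtype.val) := by
    ext (a | x) (b | y)
    · by_cases h : a = v
      · subst h
        by_cases h' : b = a
        · subst h'; simp
        · simp [h']
      · simp [Matrix.updateRow_apply, h, glueMat, Ne.symm h]
    · by_cases h : a = v
      · subst h; simp
      · simp [Matrix.updateRow_apply, h, glueMat]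
    · simp [Matrix.updateRow_apply, glueMat]
    · simp [Matrix.updateRow_apply, glueMat]
  rw [pointMinor, this, Matrix.det_fromBlocks_zero₁₂, det_submatrix_ne]
  rfl

omit [Fintype V] [Fintype W] in
theorem updateRow_glueMat_of_ne (A : Matrix V V R) {u v : V} (h : u ≠ v) (B : Matrix W W R)
    (w : W) (r : V → R) :
    (glueMat A v B w).updateRow (.inl u) (Sum.elim r 0) = glueMat (A.updateRow u r) v B w := by
  ext (a | x) (b | y)
  · by_cases h' : a = u
    · subst h'; simp [glueMat, Ne.symm h]
    · simp [Matrix.updateRow_apply, h', glueMat]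
  · by_cases h' : a = u
    · subst h'; simp [glueMat, h]
    · simp [Matrix.updateRow_apply, h', glueMat]
  · simp [Matrix.updateRow_apply, glueMat]
  · simp [Matrix.updateRow_apply, glueMat]

omit [Fintype V] [Fintype W] in
theorem single_inl_eq (w : W) (u : V) :
    (Pi.single (.inl u) 1 : GlueVertex V w → R) = Sum.elim (Pi.single u 1) 0 := by
  ext (a | y)
  · by_cases h : a = u
    · subst h; simp
    · simp [h]
  · simp

theorem pointMinor_glueMat_of_ne (A : Matrix V V R) {u v : V} (h : u ≠ v) (B : Matrix W W R)
    (w : W) : pointMinor (glueMat A v B w) (.inl u) =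
      (glueMat (A.updateRow u (Pi.single u 1)) v B w).det := by
  rw [pointMinor, single_inl_eq, updateRow_glueMat_of_ne A h]

omit [Fintype V] [Fintype W] in
theorem scaleRow_glueMat_of_ne (A : Matrix V V R) {u v : V} (h : u ≠ v) (B : Matrix W W R)
    (w : W) (q r : R) :
    scaleRow (glueMat A v B w) (.inl u) q r = glueMat (scaleRow A u q r) v B w := by
  rw [scaleRow, scaleRow, ← updateRow_glueMat_of_ne A h, single_inl_eq]
  congr 1
  ext (a | y)
  · simp only [glueMat, Pi.add_apply, Pi.smul_apply, Sum.elim_inl, Matrix.fromBlocks_apply₁₁]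
    simp [Ne.symm h]
  · simp [glueMat, h]

/-- For the determinant, a glued part `B` amounts to a change of the row `v`. This allows to compute
the determinant of a graph with several glued parts from the matrix of its core. -/
theorem det_glueMat_eq_det_scaleRow (A : Matrix V V R) (v : V) (B : Matrix W W R) (w : W) :
    (glueMat A v B w).det =
      (scaleRow A v (pointMinor B w) (B.det - pointMinor B w)).det := by
  rw [det_glueMat, det_scaleRow]

end GlueMatrix

/-! ### The polynomial `det (1 + t L)` -/

section LapPoly

variable {V W : Type*} [Fintype V] [Fintype W]

open Classical in
/-- The matrix `1 + t L(G)`, where `t` is the polynomial variable `X`. -/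
noncomputable def lapPoly (G : SimpleGraph V) : Matrix V V ℝ[X] :=
  1 + (X : ℝ[X]) • (G.lapMatrix ℝ).map C

open Classical in
theorem lapPoly_apply (G : SimpleGraph V) (x y : V) :
    lapPoly G x y = (if x = y then 1 + X * ∑ z, (if G.Adj x z then 1 else 0) else 0) -
      X * (if G.Adj x y then 1 else 0) := by
  have : (G.degree x : ℝ[X]) = ∑ z, (if G.Adj x z then (1 : ℝ[X]) else 0) := by
    rw [Finset.sum_boole, ← G.card_neighborFinset_eq_degree]
    congr 2
    ext; simp
  rw [← this]
  by_cases h : x = y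
  · subst h; simp [lapPoly, lapMatrix, degMatrix]
  · by_cases h' : G.Adj x y <;> simp [lapPoly, lapMatrix, degMatrix, h, h']

open Classical in
theorem det_lapPoly (G : SimpleGraph V) :
    (lapPoly G).det = (G.lapMatrix ℝ).charpoly.reverse.comp (-X) := by
  rw [Matrix.reverse_charpoly, Matrix.charpolyRev, ← coe_compRingHom_apply, RingHom.map_det]
  congr 1
  ext i j : 1
  by_cases h : i = j
  · subst h; simp [lapPoly]
  · simp [lapPoly, h]

open Classical in
/-- The polynomial `det (1 + t L)` is the characteristic polynomial read backwards, up to the sign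
of `t`; its coefficients are thus the Laplacian coefficients. -/
theorem coeff_det_lapPoly (G : SimpleGraph V) {k : ℕ} (hk : k ≤ Fintype.card V) :
    (lapPoly G).det.coeff k = laplacianCoeff G k := by
  rw [det_lapPoly, show (-X : ℝ[X]) = C (-1) * X by simp, comp_C_mul_X_coeff, coeff_reverse,
    Matrix.charpoly_natDegree_eq_dim,
    revAt_le hk, laplacianCoeff, mul_comm]

open Classical in
theorem natDegree_det_lapPoly (G : SimpleGraph V) :
    (lapPoly G).det.natDegree ≤ Fintype.card V := by
  rw [det_lapPoly, natDegree_comp, natDegree_neg, natDegree_X, mul_one]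
  exact (reverse_natDegree_le _).trans (Matrix.charpoly_natDegree_eq_dim _).le

theorem lapPoly_submatrix {G : SimpleGraph V} {H : SimpleGraph W} (φ : G ≃g H) :
    (lapPoly H).submatrix φ φ = lapPoly G := by
  classical
  ext x y : 1
  simp only [Matrix.submatrix_apply, lapPoly_apply, φ.injective.eq_iff, φ.map_adj_iff]
  rw [← φ.toEquiv.sum_comp]
  simp [φ.map_adj_iff]

theorem det_lapPoly_congr {G : SimpleGraph V} {H : SimpleGraph W} (φ : G ≃g H) [DecidableEq V]
    [DecidableEq W] : (lapPoly G).det = (lapPoly H).det := by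
  rw [← lapPoly_submatrix φ]
  exact Matrix.det_submatrix_equiv_self φ.toEquiv _

theorem pointMinor_lapPoly_congr {G : SimpleGraph V} {H : SimpleGraph W} (φ : G ≃g H)
    [DecidableEq V] [DecidableEq W] {v : V} {w : W} (h : φ v = w) :
    pointMinor (lapPoly G) v = pointMinor (lapPoly H) w := by
  rw [pointMinor, pointMinor, ← lapPoly_submatrix φ,
    ← Matrix.det_submatrix_equiv_self φ.toEquiv ((lapPoly H).updateRow _ _)]
  congr 1
  ext x y : 1
  subst h
  simp [Matrix.updateRow_apply, φ.injective.eq_iff, Pi.single_apply]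

theorem lapPoly_glue [DecidableEq V] [DecidableEq W] (G : SimpleGraph V) (v : V)
    (H : SimpleGraph W) (w : W) :
    lapPoly (glue G v H w) = glueMat (lapPoly G) v (lapPoly H) w := by
  classical
  have hsum : ∀ x, ∑ z, (if H.Adj x z then (1 : ℝ[X]) else 0) = (if H.Adj x w then 1 else 0) +
      ∑ z : {z // z ≠ w}, (if H.Adj x z then (1 : ℝ[X]) else 0) := fun x => by
    convert Fintype.sum_eq_add_sum_subtype_ne _ w
  have h1 : ∀ a b, (glue G v H w).Adj (.inl a) (.inl b) ↔ G.Adj a b := fun _ _ => Iff.rfl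
  have h2 : ∀ a y, (glue G v H w).Adj (.inl a) (.inr y) ↔ a = v ∧ H.Adj w y := fun _ _ => Iff.rfl
  have h3 : ∀ x b, (glue G v H w).Adj (.inr x) (.inl b) ↔ b = v ∧ H.Adj w x := fun _ _ => Iff.rfl
  have h4 : ∀ x y, (glue G v H w).Adj (.inr x) (.inr y) ↔ H.Adj x y := fun _ _ => Iff.rfl
  ext (a | ⟨x, hx⟩) (b | ⟨y, hy⟩) : 1
  · rw [lapPoly_apply, Fintype.sum_sum_type]
    simp only [h1, h2, glueMat, Matrix.fromBlocks_apply₁₁, Matrix.add_apply, Matrix.smul_apply,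
      lapPoly_apply, Sum.inl.injEq]
    rw [hsum w]
    by_cases h : a = v
    · subst h
      by_cases h' : a = b
      · subst h'
        simp only [if_true, Matrix.single_apply_same, smul_eq_mul, true_and, G.irrefl, H.irrefl,
          if_false]
        ring_nf
      · simp [h']
    · by_cases h' : a = b
      · subst h'; simp [h, Ne.symm h]
      · simp [h', Ne.symm h]
  · rw [lapPoly_apply]
    simp only [h2, glueMat, Matrix.fromBlocks_apply₁₂, Matrix.of_apply, lapPoly_apply]
    by_cases h : a = v <;> simp [h, Ne.symm hy]
  · rw [lapPoly_apply]
    simp only [h3, glueMat, Matrix.fromBlocks_apply₂₁, Matrix.of_apply, lapPoly_apply]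
    by_cases h : b = v <;> simp [h, hx, H.adj_comm]
  · rw [lapPoly_apply, Fintype.sum_sum_type]
    simp only [h3, h4, glueMat, Matrix.fromBlocks_apply₂₂, Matrix.submatrix_apply,
      lapPoly_apply, hsum x]
    by_cases h : x = y
    · subst h; simp [ite_and, H.adj_comm]
    · simp [h]

open Classical in
/-- The polynomial `det (1 + t L(G))`. -/
noncomputable def detLap (G : SimpleGraph V) : ℝ[X] := (lapPoly G).det

open Classical in
/-- The principal minor of `1 + t L(G)` at `v`. -/
noncomputable def minorLap (G : SimpleGraph V) (v : V) : ℝ[X] := pointMinor (lapPoly G) v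

theorem detLap_eq [DecidableEq V] (G : SimpleGraph V) : detLap G = (lapPoly G).det := by
  unfold detLap
  congr!

theorem minorLap_eq [DecidableEq V] (G : SimpleGraph V) (v : V) :
    minorLap G v = pointMinor (lapPoly G) v := by
  unfold minorLap
  congr!

theorem detLap_glue [DecidableEq V] (G : SimpleGraph V) (v : V) (H : SimpleGraph W) (w : W)
    [inst : Fintype (GlueVertex V w)] : detLap (glue G v H w) =
      (scaleRow (lapPoly G) v (minorLap H w) (detLap H - minorLap H w)).det := by
  classical
  obtain rfl : inst = instFintypeSum V {x // x ≠ w} := Subsingleton.elim _ _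
  rw [detLap_eq, lapPoly_glue,
    det_glueMat_eq_det_scaleRow, detLap_eq, minorLap_eq]

theorem minorLap_glue_self (G : SimpleGraph V) (v : V) (H : SimpleGraph W) (w : W)
    [inst : Fintype (GlueVertex V w)] :
    minorLap (glue G v H w) (.inl v) = minorLap G v * minorLap H w := by
  classical
  obtain rfl : inst = instFintypeSum V {x // x ≠ w} := Subsingleton.elim _ _
  rw [minorLap_eq, lapPoly_glue,
    pointMinor_glueMat_self, minorLap_eq, minorLap_eq]

theorem minorLap_glue_of_ne [DecidableEq V] (G : SimpleGraph V) {u v : V} (h : u ≠ v)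
    (H : SimpleGraph W) (w : W) [inst : Fintype (GlueVertex V w)] :
    minorLap (glue G v H w) (.inl u) = (scaleRow ((lapPoly G).updateRow u (Pi.single u 1)) v
      (minorLap H w) (detLap H - minorLap H w)).det := by
  classical
  obtain rfl : inst = instFintypeSum V {x // x ≠ w} := Subsingleton.elim _ _
  rw [minorLap_eq, lapPoly_glue,
    pointMinor_glueMat_of_ne _ h, det_glueMat_eq_det_scaleRow, detLap_eq, minorLap_eq]

end LapPoly

/-! ### Degrees and connectedness of glued graphs -/

section Degrees

variable {V W : Type*} [Fintype V] [Fintype W]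

open Classical in
/-- The degree of a vertex, without decidability assumptions. -/
noncomputable def vdeg (G : SimpleGraph V) (x : V) : ℕ := ∑ y, if G.Adj x y then 1 else 0

theorem vdeg_eq_degree (G : SimpleGraph V) (x : V) [Fintype (G.neighborSet x)] :
    vdeg G x = G.degree x := by
  classical
  rw [vdeg, Finset.sum_boole, ← G.card_neighborFinset_eq_degree, Nat.cast_id]
  congr 1
  ext; simp

theorem vdeg_congr {G : SimpleGraph V} {H : SimpleGraph W} (φ : G ≃g H) (x : V) :
    vdeg H (φ x) = vdeg G x := by
  rw [vdeg, vdeg, ← φ.toEquiv.sum_comp]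
  exact Finset.sum_congr rfl fun y _ => by
    classical exact if_congr φ.map_adj_iff rfl rfl

open Classical in
theorem vdeg_glue_inl (G : SimpleGraph V) (v : V) (H : SimpleGraph W) (w : W) (a : V)
    [inst : Fintype (GlueVertex V w)] :
    vdeg (glue G v H w) (.inl a) = vdeg G a + if a = v then vdeg H w else 0 := by
  obtain rfl : inst = instFintypeSum V {x // x ≠ w} := Subsingleton.elim _ _
  have h := Fintype.sum_eq_add_sum_subtype_ne (fun z => if H.Adj w z then 1 else 0) w
  rw [if_neg H.irrefl, zero_add] at h
  rw [vdeg, vdeg, vdeg, Fintype.sum_sum_type, h]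
  congr 1
  by_cases h : a = v <;> simp [glue, h]

theorem vdeg_glue_inr (G : SimpleGraph V) (v : V) (H : SimpleGraph W) (w : W)
    (x : {x : W // x ≠ w}) [inst : Fintype (GlueVertex V w)] :
    vdeg (glue G v H w) (.inr x) = vdeg H x.1 := by
  classical
  obtain rfl : inst = instFintypeSum V {x // x ≠ w} := Subsingleton.elim _ _
  have h := Fintype.sum_eq_add_sum_subtype_ne (fun z => if H.Adj x z then 1 else 0) w
  rw [vdeg, vdeg, Fintype.sum_sum_type, h]
  congr 1
  have h1 : ∀ a, (if (glue G v H w).Adj (.inr x) (.inl a) then 1 else 0) =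
      if a = v then (if H.Adj x w then 1 else 0) else 0 := fun a => by
    by_cases h : a = v <;> simp [glue, h, H.adj_comm]
  simp [h1]

omit [Fintype V] [Fintype W] in
theorem connected_glue {G : SimpleGraph V} {H : SimpleGraph W} (hG : G.Connected)
    (hH : H.Connected) (v : V) (w : W) : (glue G v H w).Connected := by
  classical
  have h1 : ∀ a b, G.Reachable a b → (glue G v H w).Reachable (.inl a) (.inl b) := fun a b h =>
    h.map (⟨.inl, fun h => h⟩ : G →g glue G v H w)
  let f : H →g glue G v H w := ⟨glueInr v w, fun {x y} h => by
    by_cases hx : x = w <;> by_cases hy : y = w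
    · subst hx hy; exact (H.irrefl h).elim
    · subst hx; simpa [glueInr, hy, glue] using h
    · subst hy; simpa [glueInr, hx, glue] using h.symm
    · simpa [glueInr, hx, hy, glue] using h⟩
  have fw : f w = .inl v := dif_pos rfl
  have h2 : ∀ x : {x // x ≠ w}, (glue G v H w).Reachable (.inl v) (.inr x) := fun x => by
    have h := (hH.preconnected w x.1).map f
    rwa [fw, show f x.1 = .inr x from dif_neg x.2] at h
  have h3 : ∀ y, (glue G v H w).Reachable (.inl v) y := by
    rintro (a | x)
    · exact h1 _ _ (hG.preconnected _ _)
    · exact h2 x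
  exact (connected_iff_exists_forall_reachable _).2 ⟨_, h3⟩

end Degrees

/-! ### Numerical invariants of isomorphism classes -/

namespace FramedClass

open FramedGraph

/-- The polynomial `det (1 + t L)`, whose coefficients are the Laplacian coefficients. -/
noncomputable def P (c : FramedClass I) : ℝ[X] :=
  Quotient.lift (fun F : FramedGraph I => detLap F.graph)
    (by rintro _ _ ⟨φ, _⟩; classical exact det_lapPoly_congr φ) c

/-- The principal minor of `1 + t L` at the root. -/
noncomputable def Q (a : FramedClass Unit) : ℝ[X] :=
  Quotient.lift (fun A : FramedGraph Unit => minorLap A.graph (A.pt ()))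
    (by rintro _ _ ⟨φ, h⟩; classical exact pointMinor_lapPoly_congr φ (h ())) a

/-- The difference of `det (1 + t L)` and its principal minor at the root. Under the
identification of roots, `Q` is multiplicative, and `R` satisfies a product rule (`R_mul`). -/
noncomputable def R (a : FramedClass Unit) : ℝ[X] := P a - Q a

/-- The number of vertices. -/
noncomputable def order (c : FramedClass I) : ℕ :=
  Quotient.lift (fun F : FramedGraph I => Fintype.card F.V)
    (by rintro _ _ ⟨φ, _⟩; exact Fintype.card_congr φ.toEquiv) c

/-- The sum of all degrees. -/
noncomputable def degreeSum (c : FramedClass I) : ℕ :=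
  Quotient.lift (fun F : FramedGraph I => ∑ x, vdeg F.graph x)
    (by
      rintro _ _ ⟨φ, _⟩
      rw [← φ.toEquiv.sum_comp]
      exact Finset.sum_congr rfl fun x _ => (vdeg_congr φ x).symm) c

open Classical in
/-- The number of unmarked leaves. Marked vertices are left out, so that this number is additive
under attaching. -/
noncomputable def leaves (c : FramedClass I) : ℕ :=
  Quotient.lift (fun F : FramedGraph I =>
      ∑ x, if (∀ i, F.pt i ≠ x) ∧ vdeg F.graph x = 1 then 1 else 0)
    (by
      rintro A B ⟨φ, h⟩
      rw [← φ.toEquiv.sum_comp]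
      refine Finset.sum_congr rfl fun x _ => ?_
      have h1 : (∀ i, B.pt i ≠ φ x) ↔ ∀ i, A.pt i ≠ x :=
        forall_congr' fun i => by rw [← h i, φ.injective.ne_iff]
      have h2 : vdeg B.graph (φ.toEquiv x) = vdeg A.graph x := vdeg_congr φ x
      rw [h2]
      exact if_congr (and_congr_left' h1.symm) rfl rfl) c

/-- The degree of the root. -/
noncomputable def rootDegree (a : FramedClass Unit) : ℕ :=
  Quotient.lift (fun A : FramedGraph Unit => vdeg A.graph (A.pt ()))
    (by rintro A B ⟨φ, h⟩; rw [← h (), vdeg_congr φ]) a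

/-- Connectedness. -/
def IsConnected (c : FramedClass I) : Prop :=
  Quotient.lift (fun F : FramedGraph I => F.graph.Connected)
    (by rintro A B ⟨φ, _⟩; exact propext φ.connected_iff) c

/-! ### Effect of the constructions on the polynomials -/

theorem P_reframe (c : FramedClass I) (σ : J → I) : P (c.reframe σ) = P c := by
  induction c using ind with | _ F
  rfl

theorem Q_mul (a b : FramedClass Unit) : Q (a * b) = a.Q * b.Q := by
  induction a using ind with | _ A
  induction b using ind with | _ B
  exact @minorLap_glue_self _ _ _ _ _ _ _ _ (_)

theorem P_mul (a b : FramedClass Unit) : P (a * b) = b.Q * a.P + b.R * a.Q := by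
  induction a using ind with | _ A
  induction b using ind with | _ B
  classical
  refine (@detLap_glue _ _ _ _ _ _ _ _ _ (_)).trans ?_
  rw [det_scaleRow, ← detLap_eq, ← minorLap_eq]
  rfl

theorem R_mul (a b : FramedClass Unit) : R (a * b) = a.Q * b.R + a.R * b.Q := by
  rw [R, P_mul, Q_mul]
  simp only [R]
  ring

theorem P_eq (a : FramedClass Unit) : P a = a.Q + a.R := by rw [R]; ring

theorem P_one : P (1 : FramedClass Unit) = 1 := by
  have h : P (1 : FramedClass Unit) = detLap (⊥ : SimpleGraph Unit) := rfl
  classical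
  rw [h, detLap_eq, Matrix.det_unique, lapPoly_apply]
  simp

theorem Q_one : Q 1 = 1 := by
  have h : Q (1 : FramedClass Unit) = minorLap (⊥ : SimpleGraph Unit) () := rfl
  classical
  rw [h, minorLap_eq, pointMinor, Matrix.det_unique]
  simp

theorem R_one : R 1 = 0 := by rw [R, P_one, Q_one, sub_self]

theorem lapPoly_edge : lapPoly (⊤ : SimpleGraph (Fin 2)) = !![1 + X, -X; -X, 1 + X] := by
  classical
  ext i j : 1
  rw [lapPoly_apply, Fin.sum_univ_two]
  fin_cases i <;> fin_cases j <;> simp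

theorem P_ext (a : FramedClass Unit) :
    P a.ext = (1 + X) * ((1 + X) * a.Q + a.R) - X ^ 2 * a.Q := by
  induction a using ind with | _ A
  refine (@detLap_glue (Fin 2) _ _ _ _ ⊤ 1 A.graph (A.pt ()) (_)).trans ?_
  change (scaleRow _ _ (Q A.cls) (R A.cls)).det = _
  rw [lapPoly_edge]
  simp [scaleRow, Matrix.det_fin_two]
  ring

theorem Q_ext (a : FramedClass Unit) : Q a.ext = (1 + X) * a.Q + a.R := by
  induction a using ind with | _ A
  refine (@minorLap_glue_of_ne (Fin 2) _ _ _ _ ⊤ 0 1 (by simp) A.graph (A.pt ()) (_)).trans ?_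
  change (scaleRow _ _ (Q A.cls) (R A.cls)).det = _
  rw [lapPoly_edge]
  simp [scaleRow, Matrix.det_fin_two]
  ring

theorem R_ext (a : FramedClass Unit) : R a.ext = X * (a.Q + a.R) := by
  rw [R, P_ext, Q_ext]
  ring

theorem lapPoly_square : lapPoly (cycleGraph 4) =
    !![1 + 2 * X, -X, 0, -X; -X, 1 + 2 * X, -X, 0;
      0, -X, 1 + 2 * X, -X; -X, 0, -X, 1 + 2 * X] := by
  classical
  have h : ∀ i j : Fin 4, (cycleGraph 4).Adj i j ↔ i - j = 1 ∨ j - i = 1 := fun i j => by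
    rw [cycleGraph_adj]
  ext i j : 1
  rw [lapPoly_apply, Fin.sum_univ_four]
  simp only [h]
  have h2 : (-2 : Fin 4) ≠ 1 := by decide
  have h3 : (-3 : Fin 4) = 1 := by decide
  fin_cases i <;> fin_cases j <;> simp [h2, h3] <;> ring

/-- Rooted graphs attached to the four vertices of the cycle of order four, in cyclic order. -/
noncomputable def quad (a b c d : FramedClass Unit) : FramedClass (Fin 4) :=
  (((square.cls.attach 0 a).attach 1 b).attach 2 c).attach 3 d

theorem P_quad (a b c d : FramedClass Unit) : P (quad a b c d) =
    ((1 + 2 * X) * a.Q + a.R) * ((1 + 2 * X) * b.Q + b.R) * ((1 + 2 * X) * c.Q + c.R) *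
        ((1 + 2 * X) * d.Q + d.R) -
      X ^ 2 * (((1 + 2 * X) * a.Q + a.R) * ((1 + 2 * X) * b.Q + b.R) * c.Q * d.Q +
        ((1 + 2 * X) * b.Q + b.R) * ((1 + 2 * X) * c.Q + c.R) * d.Q * a.Q +
        ((1 + 2 * X) * c.Q + c.R) * ((1 + 2 * X) * d.Q + d.R) * a.Q * b.Q +
        ((1 + 2 * X) * d.Q + d.R) * ((1 + 2 * X) * a.Q + a.R) * b.Q * c.Q) := by
  induction a using ind with | _ A
  induction b using ind with | _ B
  induction c using ind with | _ C
  induction d using ind with | _ D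
  classical
  refine (detLap_glue (glue (glue (glue (cycleGraph 4) 0 A.graph (A.pt ())) (.inl 1) B.graph
    (B.pt ())) (.inl (.inl 2)) C.graph (C.pt ())) (.inl (.inl (.inl 3))) D.graph (D.pt ())).trans ?_
  change (scaleRow _ _ (Q D.cls) (R D.cls)).det = _
  rw [lapPoly_glue, scaleRow_glueMat_of_ne _ (by simp), det_glueMat_eq_det_scaleRow,
    lapPoly_glue, scaleRow_glueMat_of_ne _ (by simp), scaleRow_glueMat_of_ne _ (by simp),
    det_glueMat_eq_det_scaleRow, lapPoly_glue, scaleRow_glueMat_of_ne _ (by simp),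
    scaleRow_glueMat_of_ne _ (by simp), scaleRow_glueMat_of_ne _ (by simp),
    det_glueMat_eq_det_scaleRow]
  simp only [← detLap_eq, ← minorLap_eq]
  change (scaleRow (scaleRow (scaleRow (scaleRow _ _ (Q D.cls) (R D.cls)) _ (Q C.cls) (R C.cls))
    _ (Q B.cls) (R B.cls)) _ (Q A.cls) (R A.cls)).det = _
  rw [lapPoly_square]
  generalize Q A.cls = qa, R A.cls = ra, Q B.cls = qb, R B.cls = rb, Q C.cls = qc, R C.cls = rc,
    Q D.cls = qd, R D.cls = rd
  have : scaleRow (scaleRow (scaleRow (scaleRow !![1 + 2 * X, -X, 0, -X; -X, 1 + 2 * X, -X, 0;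
      0, -X, 1 + 2 * X, -X; -X, 0, -X, 1 + 2 * X] 3 qd rd) 2 qc rc) 1 qb rb) 0 qa ra =
      !![(1 + 2 * X) * qa + ra, -X * qa, 0, -X * qa; -X * qb, (1 + 2 * X) * qb + rb, -X * qb, 0;
      0, -X * qc, (1 + 2 * X) * qc + rc, -X * qc; -X * qd, 0, -X * qd, (1 + 2 * X) * qd + rd] := by
    ext i j : 1
    fin_cases i <;> fin_cases j <;> simp [scaleRow] <;> ring
  rw [this]
  simp [Matrix.det_succ_row_zero, Fin.sum_univ_succ, Fin.succAbove]
  ring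

end FramedClass

/-! ### Counting vertices, leaves and edges -/

theorem sum_vdeg_glue {V W : Type*} [Fintype V] [Fintype W] (G : SimpleGraph V) (v : V)
    (H : SimpleGraph W) (w : W) [inst : Fintype (GlueVertex V w)] :
    ∑ x, vdeg (glue G v H w) x = ∑ x, vdeg G x + ∑ x, vdeg H x := by
  classical
  obtain rfl : inst = instFintypeSum V {x // x ≠ w} := Subsingleton.elim _ _
  rw [Fintype.sum_sum_type, Fintype.sum_eq_add_sum_subtype_ne (vdeg H) w, ← add_assoc]
  congr 1
  · simp [vdeg_glue_inl, Finset.sum_add_distrib]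
  · exact Finset.sum_congr rfl fun x _ => vdeg_glue_inr _ _ _ _ _

theorem card_glueVertex {V W : Type*} [Fintype V] [Fintype W] (w : W)
    [inst : Fintype (GlueVertex V w)] :
    Fintype.card (GlueVertex V w) + 1 = Fintype.card V + Fintype.card W := by
  classical
  obtain rfl : inst = instFintypeSum V {x // x ≠ w} := Subsingleton.elim _ _
  have : 0 < Fintype.card W := Fintype.card_pos_iff.2 ⟨w⟩
  rw [Fintype.card_sum, Fintype.card_subtype_compl, Fintype.card_subtype_eq]
  omega

namespace FramedClass

open FramedGraph

theorem order_attach (c : FramedClass I) (i : I) (a : FramedClass Unit) :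
    order (c.attach i a) + 1 = order c + order a := by
  induction c using ind with | _ F
  induction a using ind with | _ A
  exact @card_glueVertex _ _ _ _ _ (_)

theorem degreeSum_attach (c : FramedClass I) (i : I) (a : FramedClass Unit) :
    degreeSum (c.attach i a) = degreeSum c + degreeSum a := by
  induction c using ind with | _ F
  induction a using ind with | _ A
  exact @sum_vdeg_glue _ _ _ _ _ _ _ _ (_)

/-- The definition of `leaves`, for an arbitrary `Fintype` instance and a decidable description of
the leaves. -/
theorem leaves_cls (F : FramedGraph I) (p : F.V → Prop) [DecidablePred p]
    (hp : ∀ x, p x ↔ (∀ i, F.pt i ≠ x) ∧ vdeg F.graph x = 1) (inst : Fintype F.V) :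
    leaves F.cls = ∑ x, if p x then 1 else 0 := by
  classical
  obtain rfl : inst = F.fintype := Subsingleton.elim _ _
  change Finset.sum _ _ = _
  exact Finset.sum_congr rfl fun x _ => if_congr (hp x).symm rfl rfl

theorem leaves_attach (c : FramedClass I) (i : I) (a : FramedClass Unit) :
    leaves (c.attach i a) = leaves c + leaves a := by
  induction c using ind with | _ F
  induction a using ind with | _ A
  classical
  have h := leaves_cls (F.attach i A)
    (fun x : F.V ⊕ {x // x ≠ A.pt ()} => (∀ j, (Sum.inl (F.pt j)) ≠ x) ∧
      vdeg (F.attach i A).graph x = 1) (fun x => Iff.rfl) (instFintypeSum F.V {x // x ≠ A.pt ()})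
  have hF := leaves_cls F (fun x => (∀ j, F.pt j ≠ x) ∧ vdeg F.graph x = 1) (fun _ => Iff.rfl)
    F.fintype
  have hA := leaves_cls A (fun x => x ≠ A.pt () ∧ vdeg A.graph x = 1)
    (fun x => and_congr_left' ⟨fun h _ => Ne.symm h, fun h => Ne.symm (h ())⟩) A.fintype
  refine (h.trans (Fintype.sum_sum_type _)).trans ?_
  rw [hF, hA, Fintype.sum_eq_add_sum_subtype_ne _ (A.pt ()), if_neg (by simp), zero_add]
  congr 1
  · refine Finset.sum_congr rfl fun x _ => if_congr ?_ rfl rfl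
    have h2 := @vdeg_glue_inl _ _ _ _ F.graph (F.pt i) A.graph (A.pt ()) x (F.attach i A).fintype
    simp only [ne_eq, Sum.inl.injEq]
    refine and_congr_right fun hx => ?_
    rw [if_neg (Ne.symm (hx i)), add_zero] at h2
    exact Eq.congr_left h2
  · refine Finset.sum_congr rfl fun x _ => if_congr ?_ rfl rfl
    have h2 := @vdeg_glue_inr _ _ _ _ F.graph (F.pt i) A.graph (A.pt ()) x (F.attach i A).fintype
    simp only [ne_eq, reduceCtorEq, not_false_eq_true, implies_true, true_and, x.2]
    exact Eq.congr_left h2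

theorem isConnected_attach {c : FramedClass I} {a : FramedClass Unit} (hc : IsConnected c)
    (ha : IsConnected a) (i : I) : IsConnected (c.attach i a) := by
  induction c using ind with | _ F
  induction a using ind with | _ A
  exact connected_glue hc ha _ _

theorem order_mul (a b : FramedClass Unit) : order (a * b) + 1 = order a + order b :=
  order_attach a () b

theorem leaves_mul (a b : FramedClass Unit) : leaves (a * b) = leaves a + leaves b :=
  leaves_attach a () b

theorem rootDegree_mul (a b : FramedClass Unit) :
    rootDegree (a * b) = rootDegree a + rootDegree b := by
  induction a using ind with | _ A
  induction b using ind with | _ B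
  exact (@vdeg_glue_inl _ _ _ _ _ _ _ _ _ (_)).trans (by rw [if_pos rfl]; rfl)

theorem order_one : order (1 : FramedClass Unit) = 1 := Fintype.card_unit

theorem leaves_one : leaves (1 : FramedClass Unit) = 0 :=
  (leaves_cls single (fun _ => False) (fun _ => ⟨False.elim, fun h => h.1 () rfl⟩)
    single.fintype).trans (by simp)

theorem rootDegree_one : rootDegree 1 = 0 := by
  change vdeg (⊥ : SimpleGraph Unit) () = 0
  simp [vdeg]

theorem order_ext (a : FramedClass Unit) : order a.ext = order a + 1 := by
  induction a using ind with | _ A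
  have h := @card_glueVertex (Fin 2) A.V _ _ (A.pt ()) (link.attach 1 A).fintype
  change Fintype.card (link.attach 1 A).V + 1 = _ at h
  change Fintype.card (link.attach 1 A).V = Fintype.card A.V + 1
  rw [Fintype.card_fin] at h
  omega

/-- An extension creates no leaf unless the old root was an isolated vertex: the new root is marked,
and the degree of the old root grows by one. -/
theorem leaves_ext (a : FramedClass Unit) :
    leaves a.ext = leaves a + if rootDegree a = 0 then 1 else 0 := by
  induction a using ind with | _ A
  classical
  set E := link.attach 1 A with hE
  have h01 : E.pt 1 ≠ E.pt 0 := Sum.inl_injective.ne (by simp [link])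
  obtain ⟨p, hp⟩ : ∃ p : E.V → Prop, ∀ x, p x ↔ (x ≠ E.pt 0 ∧ x ≠ E.pt 1) ∧ vdeg E.graph x = 1 :=
    ⟨_, fun _ => Iff.rfl⟩
  obtain ⟨q, hq⟩ : ∃ q : E.V → Prop, ∀ x, q x ↔ x ≠ E.pt 0 ∧ vdeg E.graph x = 1 :=
    ⟨_, fun _ => Iff.rfl⟩
  have h1 := leaves_cls E p (fun x => (hp x).trans
    (and_congr_left' (by rw [Fin.forall_fin_two, ne_comm, @ne_comm _ x]))) E.fintype
  have h2 := @leaves_cls _ (E.reframe fun _ : Unit => (0 : Fin 2)) q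
    (fun x => Classical.propDecidable (q x)) (fun x => (hq x).trans
    (and_congr_left' ⟨fun h _ => Ne.symm h, fun h => Ne.symm (h ())⟩)) E.fintype
  have h3 : leaves E.cls = leaves A.cls := by
    rw [hE, ← attach_cls, leaves_attach, add_eq_right]
    exact (leaves_cls link (fun _ => False) (fun x => ⟨False.elim, fun h => h.1 x rfl⟩)
      link.fintype).trans
      (by simp)
  have h4 : vdeg E.graph (E.pt 1) = 1 + rootDegree A.cls := by
    refine (@vdeg_glue_inl (Fin 2) _ _ _ ⊤ 1 A.graph (A.pt ()) 1 (_)).trans ?_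
    rw [if_pos rfl]
    congr 1
    simp [vdeg]
  change leaves ((E.reframe fun _ : Unit => (0 : Fin 2)).cls) = _
  rw [h2, ← h3, h1]
  have h5 : ∀ (p : E.V → Prop) [DecidablePred p], ∑ x, (if p x then 1 else 0) =
      (if p (E.pt 1) then 1 else 0) + ∑ x : {x // x ≠ E.pt 1}, if p x then 1 else 0 :=
    fun p _ => Fintype.sum_eq_add_sum_subtype_ne _ _
  refine (h5 q).trans ?_
  rw [h5 p, if_neg (fun h => ((hp _).1 h).1.2 rfl), zero_add, add_comm]
  congr 1
  · refine Finset.sum_congr rfl fun x _ => if_congr ?_ rfl rfl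
    rw [hp, hq]
    simp [x.2]
  · refine if_congr ?_ rfl rfl
    rw [hq, h4]
    simp [h01]

theorem rootDegree_ext (a : FramedClass Unit) : rootDegree a.ext = 1 := by
  induction a using ind with | _ A
  refine (@vdeg_glue_inl (Fin 2) _ _ _ ⊤ 1 A.graph (A.pt ()) 0 (_)).trans ?_
  simp [vdeg]

/-- Rooted trees: everything obtained from the single vertex by adding a new root below the old
one and by identifying roots. -/
inductive TreeClass : FramedClass Unit → Prop
  | one : TreeClass 1
  | ext {a} : TreeClass a → TreeClass a.ext
  | mul {a b} : TreeClass a → TreeClass b → TreeClass (a * b)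

theorem TreeClass.order_pos {a} (h : TreeClass a) : 0 < order a := by
  induction h with
  | one => rw [order_one]; exact one_pos
  | ext _ _ => rw [order_ext]; omega
  | @mul a b _ _ ha hb => have := order_mul a b; omega

theorem degreeSum_mul (a b : FramedClass Unit) : degreeSum (a * b) = degreeSum a + degreeSum b :=
  degreeSum_attach a () b

theorem degreeSum_reframe (c : FramedClass I) (σ : J → I) :
    degreeSum (c.reframe σ) = degreeSum c := by
  induction c using ind with | _ F
  rfl

theorem isConnected_reframe (c : FramedClass I) (σ : J → I) :
    IsConnected (c.reframe σ) ↔ IsConnected c := by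
  induction c using ind with | _ F
  rfl

theorem TreeClass.isConnected {a} (h : TreeClass a) : IsConnected a := by
  induction h with
  | one => exact (connected_bot_iff (V := Unit)).2 ⟨inferInstance, inferInstance⟩
  | ext _ h =>
    have : IsConnected link.cls := connected_top (V := Fin 2)
    exact (isConnected_reframe _ _).2 (isConnected_attach this h 1)
  | mul _ _ ha hb => exact isConnected_attach ha hb ()

theorem TreeClass.degreeSum_add_two {a} (h : TreeClass a) : degreeSum a + 2 = 2 * order a := by
  induction h with
  | one =>
    have : degreeSum (1 : FramedClass Unit) = 0 := by
      change ∑ x : Unit, vdeg (⊥ : SimpleGraph Unit) x = 0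
      simp [vdeg]
    rw [this, order_one]
  | @ext a _ h =>
    have : degreeSum link.cls = 2 := by
      change ∑ x : Fin 2, vdeg (⊤ : SimpleGraph (Fin 2)) x = 2
      simp [vdeg]
    rw [order_ext, FramedClass.ext, degreeSum_reframe, degreeSum_attach, this]
    omega
  | @mul a b ha' hb' ha hb =>
    have := order_mul a b
    rw [degreeSum_mul]
    have := ha'.order_pos
    omega

theorem TreeClass.eq_one_or {a} (h : TreeClass a) :
    a = 1 ∨ 2 ≤ order a ∧ 0 < rootDegree a := by
  induction h with
  | one => exact .inl rfl
  | ext h _ => right; rw [order_ext, rootDegree_ext]; have := h.order_pos; omega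
  | @mul a b ha' hb' ha hb =>
    have h1 := order_mul a b
    have h2 := rootDegree_mul a b
    have := ha'.order_pos
    have := hb'.order_pos
    rcases ha with rfl | ha
    · rwa [one_mul]
    · right; omega

end FramedClass

/-! ### Unicyclic graphs of girth four are cycles with attached trees -/

namespace FramedClass

open FramedGraph

theorem graft_congr {F F' : FramedGraph I} (φ : F.graph ≃g F'.graph)
    (h : ∀ i, φ (F.pt i) = F'.pt i) (y : F.V) : (F.graft y).cls = (F'.graft (φ y)).cls :=
  cls_eq.2 ⟨glueCongr φ Iso.refl rfl rfl, fun i => congrArg Sum.inl (h i)⟩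

theorem graft_attach_inl (F : FramedGraph I) (i : I) (A : FramedGraph Unit) (v : F.V) :
    ((F.attach i A).graft (.inl v)).cls = ((F.graft v).attach i A).cls :=
  cls_eq.2 ⟨glueGlueComm _ _ _ _ _ _ _, fun _ => rfl⟩

/-- A leaf added at a vertex of the attached graph `A` can be added before attaching. -/
theorem graft_attach_inr (F : FramedGraph I) (i : I) (A : FramedGraph Unit)
    (x : {x // x ≠ A.pt ()}) :
    ((F.attach i A).graft (.inr x)).cls = (F.attach i (A.graft x.1)).cls := by
  refine (cls_eq.2 ⟨(glueAssoc F.graph (F.pt i) A.graph (A.pt ()) x.1 (⊤ : SimpleGraph (Fin 2))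
    0).trans (glueCongr Iso.refl Iso.refl ?_ rfl), fun _ => rfl⟩).symm
  simp [glueInr, x.2]

theorem ext_one_eq : ext 1 = (link.reframe fun _ : Unit => (0 : Fin 2)).cls := by
  rw [ext, attach_one, reframe_cls]

theorem graft_pt (F : FramedGraph I) (i : I) :
    (F.graft (F.pt i)).cls = F.cls.attach i (ext 1) := by
  rw [ext_one_eq]
  exact cls_eq.2 ⟨glueCongr Iso.refl Iso.refl rfl rfl, fun _ => rfl⟩

/-- Adding a leaf to a rooted tree gives a rooted tree. -/
theorem TreeClass.graft {a : FramedClass Unit} (ha : TreeClass a) :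
    ∀ (A : FramedGraph Unit), A.cls = a → ∀ y, TreeClass (A.graft y).cls := by
  induction ha with
  | one =>
    intro A hA y
    obtain ⟨φ, h⟩ := cls_eq.1 hA
    rw [graft_congr φ h]
    have : φ y = single.pt () := Subsingleton.elim (α := Unit) _ _
    rw [this, graft_pt]
    exact .mul .one (.ext .one)
  | @ext a ha ih =>
    intro A hA y
    induction a using ind with | _ B
    obtain ⟨φ, h⟩ := cls_eq.1 (hA.trans (rfl : _ = ((link.attach 1 B).reframe fun _ => 0).cls))
    rw [graft_congr φ h]
    rcases hy : φ y with v | x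
    · obtain rfl | rfl := (by decide : ∀ v : Fin 2, v = 0 ∨ v = 1) v
      · have h2 := graft_pt ((link.attach 1 B).reframe fun _ : Unit => (0 : Fin 2)) ()
        refine h2.symm ▸ ?_
        exact .mul (.ext ha) (.ext .one)
      · have h2 : ((link.attach 1 B).graft (.inl (1 : Fin 2))).cls =
            (link.cls.attach 1 B.cls).attach 1 (FramedClass.ext 1) := graft_pt (link.attach 1 B) 1
        rw [attach_attach] at h2
        have ht : TreeClass (FramedClass.ext (B.cls * FramedClass.ext 1)) :=
          .ext (.mul ha (.ext .one))
        have h3 : TreeClass (((link.attach 1 B).graft (.inl (1 : Fin 2))).cls.reframe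
            fun _ : Unit => (0 : Fin 2)) := h2 ▸ ht
        exact h3
    · have h3 : TreeClass (((link.attach 1 B).graft (.inr x)).cls.reframe
          fun _ : Unit => (0 : Fin 2)) :=
        graft_attach_inr link 1 B x ▸ TreeClass.ext (ih B rfl x.1)
      exact h3
  | @mul a b ha hb iha ihb =>
    intro A hA y
    induction a using ind with | _ B
    induction b using ind with | _ C
    obtain ⟨φ, h⟩ := cls_eq.1 (hA.trans (rfl : _ = (B.attach () C).cls))
    rw [graft_congr φ h]
    rcases φ y with v | x
    · rw [graft_attach_inl]
      exact .mul (iha B rfl v) hb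
    · rw [graft_attach_inr]
      exact .mul ha (ihb C rfl x.1)

/-- Graphs obtained from the cycle of order four by attaching rooted trees to its vertices. -/
inductive SquareClass : FramedClass (Fin 4) → Prop
  | base : SquareClass square.cls
  | attach {c a} (i : Fin 4) : SquareClass c → TreeClass a → SquareClass (c.attach i a)

theorem SquareClass.graft {c : FramedClass (Fin 4)} (hc : SquareClass c) :
    ∀ (F : FramedGraph (Fin 4)), F.cls = c → ∀ y, SquareClass (F.graft y).cls := by
  induction hc with
  | base =>
    intro F hF y
    obtain ⟨φ, h⟩ := cls_eq.1 hF
    rw [graft_congr φ h]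
    have h2 := graft_pt square (φ y)
    exact h2.symm ▸ .attach _ .base (.ext .one)
  | @attach c a i hc ha ih =>
    intro F hF y
    induction c using ind with | _ B
    induction a using ind with | _ C
    obtain ⟨φ, h⟩ := cls_eq.1 (hF.trans (rfl : _ = (B.attach i C).cls))
    rw [graft_congr φ h]
    rcases φ y with v | x
    · rw [graft_attach_inl]
      exact .attach i (ih B rfl v) ha
    · rw [graft_attach_inr]
      exact .attach i hc (ha.graft C rfl x.1)

theorem SquareClass.exists_quad {c : FramedClass (Fin 4)} (hc : SquareClass c) :
    ∃ a b d e, TreeClass a ∧ TreeClass b ∧ TreeClass d ∧ TreeClass e ∧ c = quad a b d e := by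
  induction hc with
  | base => exact ⟨1, 1, 1, 1, .one, .one, .one, .one, by simp only [quad, attach_one]⟩
  | @attach c t i _ ht ih =>
    obtain ⟨a, b, d, e, ha, hb, hd, he, rfl⟩ := ih
    fin_cases i
    · exact ⟨a * t, b, d, e, .mul ha ht, hb, hd, he, by
        simp only [quad, ← attach_attach]
        rw [attach_comm _ 3, attach_comm _ 2, attach_comm _ 1]; rfl⟩
    · exact ⟨a, b * t, d, e, ha, .mul hb ht, hd, he, by
        simp only [quad, ← attach_attach]
        rw [attach_comm _ 3, attach_comm _ 2]; rfl⟩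
    · exact ⟨a, b, d * t, e, ha, hb, .mul hd ht, he, by
        simp only [quad, ← attach_attach]
        rw [attach_comm _ 3]; rfl⟩
    · exact ⟨a, b, d, e * t, ha, hb, hd, .mul he ht, by
        simp only [quad, ← attach_attach]; rfl⟩

end FramedClass

open FramedClass FramedGraph

/-- Removing a leaf `x` with neighbour `y`: the graph is recovered by adding a leaf at `y`. -/
theorem cls_eq_graft {V : Type} [Fintype V] (G : SimpleGraph V) (f : I → V) {x y : V}
    (hxy : ∀ z, G.Adj x z ↔ z = y) (hf : ∀ i, f i ≠ x) [Fintype ({x}ᶜ : Set V)]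
    (hy : y ∈ ({x}ᶜ : Set V)) :
    (⟨V, G, f⟩ : FramedGraph I).cls =
      (FramedGraph.graft (⟨({x}ᶜ : Set V), G.induce {x}ᶜ, fun i => ⟨f i, hf i⟩⟩ : FramedGraph I)
        ⟨y, hy⟩).cls := by
  classical
  let g : GlueVertex ({x}ᶜ : Set V) (0 : Fin 2) → V := Sum.elim Subtype.val fun _ => x
  have hsub : ∀ u v : {u : Fin 2 // u ≠ 0}, u = v := by
    rintro ⟨u, hu⟩ ⟨v, hv⟩
    ext
    simp only
    omega
  have hg : Function.Bijective g := by
    refine ⟨?_, fun z => ?_⟩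
    · rintro (a | u) (b | v) h
      · exact congrArg _ (Subtype.ext h)
      · exact (a.2 h).elim
      · exact (b.2 h.symm).elim
      · rw [hsub u v]
    · by_cases h : z = x
      · exact ⟨.inr ⟨1, by simp⟩, h.symm⟩
      · exact ⟨.inl ⟨z, h⟩, rfl⟩
  have hadj : ∀ u : {u : Fin 2 // u ≠ 0}, (⊤ : SimpleGraph (Fin 2)).Adj 0 u.1 := fun u =>
    Ne.symm u.2
  refine (cls_eq.2 ⟨⟨Equiv.ofBijective g hg, ?_⟩, fun i => rfl⟩).symm
  rintro (⟨a, ha⟩ | u) (⟨b, hb⟩ | v)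
  · exact Iff.rfl
  · change G.Adj a x ↔ (⟨a, ha⟩ : ({x}ᶜ : Set V)) = ⟨y, hy⟩ ∧ _
    rw [G.adj_comm, hxy, Subtype.mk.injEq]
    exact ⟨fun h => ⟨h, hadj v⟩, fun h => h.1⟩
  · change G.Adj x b ↔ (⟨b, hb⟩ : ({x}ᶜ : Set V)) = ⟨y, hy⟩ ∧ _
    rw [hxy, Subtype.mk.injEq]
    exact ⟨fun h => ⟨h, hadj u⟩, fun h => h.1⟩
  · rw [hsub u v]
    exact iff_of_false G.irrefl (SimpleGraph.irrefl _)

/-- A connected graph with as many edges as vertices that contains a cycle of order four is this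
cycle with rooted trees attached to it. The proof removes leaves one by one; if there is no leaf,
all degrees are two by the edge count, and the cycle is closed under adjacency. -/
theorem squareClass_of_connected (n : ℕ) : ∀ (V : Type) [Fintype V] (G : SimpleGraph V)
    (f : Fin 4 → V), Fintype.card V = n → G.Connected → ∑ x, vdeg G x = 2 * n →
    Function.Injective f → (∀ i j, (cycleGraph 4).Adj i j → G.Adj (f i) (f j)) →
    SquareClass (⟨V, G, f⟩ : FramedGraph (Fin 4)).cls := by
  induction n with
  | zero =>
    intro V _ G f hn
    exact ((Fintype.card_eq_zero_iff.1 hn).false (f 0)).elim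
  | succ n ih =>
    intro V _ G f hn hG hsum hinj hf
    classical
    simp only [vdeg_eq_degree] at hsum
    have hcyc : ∀ i : Fin 4, (cycleGraph 4).Adj i (i + 1) ∧ (cycleGraph 4).Adj i (i + 3) ∧
        i + 1 ≠ i + 3 := by
      intro i
      simp only [cycleGraph_adj]
      fin_cases i <;> decide
    have hnb : ∀ i, {f (i + 1), f (i + 3)} ⊆ G.neighborFinset (f i) := fun i => by
      intro z hz
      rw [mem_neighborFinset]
      rcases Finset.mem_insert.1 hz with rfl | hz
      · exact hf _ _ (hcyc i).1
      · rw [Finset.mem_singleton.1 hz]; exact hf _ _ (hcyc i).2.1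
    have hcard : ∀ i, ({f (i + 1), f (i + 3)} : Finset V).card = 2 := fun i =>
      Finset.card_pair (hinj.ne (hcyc i).2.2)
    by_cases hleaf : ∃ x, G.degree x = 1
    · obtain ⟨x, hx⟩ := hleaf
      have hfx : ∀ i, f i ≠ x := fun i h => by
        have := Finset.card_le_card (hnb i)
        rw [hcard, card_neighborFinset_eq_degree, h, hx] at this
        omega
      obtain ⟨y, hxy, hy⟩ := degree_eq_one_iff_existsUnique_adj.1 hx
      have hy' : y ∈ ({x}ᶜ : Set V) := hxy.ne'
      have heq := cls_eq_graft G f (fun z => ⟨hy z, fun h => h ▸ hxy⟩) hfx hy'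
      have hf' : ∀ i j, (cycleGraph 4).Adj i j →
          (G.induce {x}ᶜ).Adj ⟨f i, hfx i⟩ ⟨f j, hfx j⟩ := fun i j h => hf i j h
      have hcV : Fintype.card ({x}ᶜ : Set V) = n := by
        rw [Fintype.card_compl_set, hn]; simp
      have hs : ∑ x, vdeg G x = ∑ z, vdeg (G.induce {x}ᶜ) z +
          ∑ z, vdeg (⊤ : SimpleGraph (Fin 2)) z := by
        have h1 := congrArg degreeSum heq
        exact h1.trans (@sum_vdeg_glue _ _ _ _ _ _ _ _ (_))
      have h2 : ∑ z, vdeg (⊤ : SimpleGraph (Fin 2)) z = 2 := by simp [vdeg]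
      simp only [vdeg_eq_degree G] at hs
      refine heq ▸ (ih _ _ (fun i => ⟨f i, hfx i⟩) hcV
        (hG.induce_compl_singleton_of_degree_eq_one hx) (by omega)
        (fun i j h => hinj (congrArg Subtype.val h)) hf').graft _ rfl _
    · have hnt : Nontrivial V := ⟨f 0, f 1, hinj.ne (by decide)⟩
      have hge : ∀ x ∈ Finset.univ, 2 ≤ G.degree x := fun x _ => by
        have h1 := hG.preconnected.degree_pos_of_nontrivial x
        have h2 : G.degree x ≠ 1 := fun h => hleaf ⟨x, h⟩
        omega
      have hdeg : ∀ x ∈ Finset.univ, 2 = G.degree x := by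
        rw [← Finset.sum_eq_sum_iff_of_le hge, hsum]
        simp [hn, mul_comm]
      have hadj : ∀ i z, G.Adj (f i) z → z = f (i + 1) ∨ z = f (i + 3) := fun i z h => by
        have h1 := Finset.eq_of_subset_of_card_le (hnb i) (by
          rw [hcard, card_neighborFinset_eq_degree, ← hdeg _ (Finset.mem_univ _)])
        have h2 : z ∈ G.neighborFinset (f i) := (mem_neighborFinset _ _ _).2 h
        rw [← h1] at h2
        simpa using h2
      have hsurj : ∀ z, ∃ i, f i = z := fun z => by
        have key : ∀ u v, G.Walk u v → (∃ i, f i = u) → ∃ i, f i = v := by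
          intro u v p
          induction p with
          | nil => exact id
          | cons h _ ih =>
            rintro ⟨i, rfl⟩
            rcases hadj i _ h with h | h
            · exact ih ⟨_, h.symm⟩
            · exact ih ⟨_, h.symm⟩
        obtain ⟨p⟩ := hG.preconnected (f 0) z
        exact key _ _ p ⟨0, rfl⟩
      have hcls : square.cls = (⟨V, G, f⟩ : FramedGraph (Fin 4)).cls := by
        refine cls_eq.2 ⟨⟨Equiv.ofBijective f ⟨hinj, hsurj⟩, fun {i j} => ⟨fun h => ?_, hf i j⟩⟩,
          fun _ => rfl⟩
        rcases hadj i _ h with h | h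
        · rw [hinj h]; exact (hcyc i).1
        · rw [hinj h]; exact (hcyc i).2.1
      exact hcls ▸ .base

/-! ### The family of graphs in terms of attached trees -/

/-- A graph with as many edges as vertices that contains a cycle of order four has girth four:
deleting an edge of this cycle leaves a tree, while a triangle would survive the deletion of an
edge of the cycle outside the triangle. -/
theorem girth_eq_four {V : Type*} [Fintype V] {G : SimpleGraph V} (hG : G.Connected)
    (hcard : G.edgeSet.ncard = Fintype.card V) {f : Fin 4 → V} (hinj : Function.Injective f)
    (hf : ∀ i j, (cycleGraph 4).Adj i j → G.Adj (f i) (f j)) : G.girth = 4 := by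
  classical
  have hadj : ∀ i : Fin 4, (cycleGraph 4).Adj i (i + 1) := by
    intro i
    rw [cycleGraph_adj]
    fin_cases i <;> decide
  have hcont : cycleGraph 4 ⊑ G := ⟨⟨⟨f, fun {i j} h => hf i j h⟩, hinj⟩⟩
  obtain ⟨v, c, hc, hlen⟩ := (cycleGraph_isContained_iff (by norm_num)).1 hcont
  have hacyc : ¬ G.IsAcyclic := fun h => h _ hc
  have h3 := three_le_girth hacyc
  have h4 := girth_le_length hc
  by_contra hne
  obtain ⟨u, w, hw, hwl⟩ := exists_girth_eq_length.2 hacyc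
  have hwl3 : w.length = 3 := by omega
  obtain ⟨i, hi⟩ : ∃ i, s(f i, f (i + 1)) ∉ w.edges := by
    by_contra! hall
    have hinj2 : Function.Injective fun i : Fin 4 => s(f i, f (i + 1)) := by
      intro i j h
      have h2 : Sym2.map f s(i, i + 1) = Sym2.map f s(j, j + 1) := h
      have h3 := Sym2.map.injective hinj h2
      clear * - h3
      revert i j
      decide
    have h1 : Finset.univ.image (fun i : Fin 4 => s(f i, f (i + 1))) ⊆ w.edges.toFinset := by
      intro e he
      obtain ⟨i, -, rfl⟩ := Finset.mem_image.1 he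
      exact List.mem_toFinset.2 (hall i)
    have h2 := (Finset.card_le_card h1).trans (List.toFinset_card_le _)
    rw [Finset.card_image_of_injective _ hinj2, Walk.length_edges, hwl3] at h2
    simp at h2
  have hstep : ∀ j, j ≠ i → (G.deleteEdges {s(f i, f (i + 1))}).Adj (f j) (f (j + 1)) := by
    intro j hj
    rw [deleteEdges_adj]
    refine ⟨hf _ _ (hadj j), fun h => hj ?_⟩
    have h2 : Sym2.map f s(j, j + 1) = Sym2.map f s(i, i + 1) := h
    have h3 := Sym2.map.injective hinj h2
    clear * - h3
    revert i j
    decide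
  have hbr : ¬ G.IsBridge s(f i, f (i + 1)) := by
    rw [isBridge_iff, not_not]
    have e : i + 1 + 1 + 1 + 1 = i := by clear * -; revert i; decide
    have a1 := (hstep (i + 1) (by clear * -; revert i; decide)).reachable
    have a2 := (hstep (i + 1 + 1) (by clear * -; revert i; decide)).reachable
    have a3 := (hstep (i + 1 + 1 + 1) (by clear * -; revert i; decide)).reachable
    rw [e] at a3
    exact ((a1.trans a2).trans a3).symm
  have htree : (G.deleteEdges {s(f i, f (i + 1))}).IsTree := by
    refine isTree_iff_connected_and_card.2 ⟨hG.connected_delete_edge_of_not_isBridge hbr, ?_⟩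
    rw [edgeSet_deleteEdges, Nat.card_eq_fintype_card (α := V), ← hcard]
    exact Set.ncard_sdiff_singleton_add_one (hf _ _ (hadj i))
  refine htree.isAcyclic _ (Walk.IsCycle.toDeleteEdges G {s(f i, f (i + 1))} hw ?_)
  rintro e he rfl
  exact hi he

/-- The isomorphism class of a graph. -/
def ofGraph {V : Type} [Fintype V] (G : SimpleGraph V) : FramedClass Empty :=
  (⟨V, G, Empty.elim⟩ : FramedGraph Empty).cls

theorem ofGraph_eq_iff {V W : Type} [Fintype V] [Fintype W] {G : SimpleGraph V}
    {H : SimpleGraph W} : ofGraph G = ofGraph H ↔ Nonempty (G ≃g H) :=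
  cls_eq.trans ⟨fun ⟨φ, _⟩ => ⟨φ⟩, fun ⟨φ⟩ => ⟨φ, fun i => i.elim⟩⟩

theorem bare_cls {I : Type} (F : FramedGraph I) : F.cls.bare = ofGraph F.graph :=
  cls_eq.2 ⟨Iso.refl, fun i => i.elim⟩

theorem P_ofGraph {V : Type} [Fintype V] (G : SimpleGraph V) : P (ofGraph G) = detLap G := rfl

namespace FramedClass

/-- The marked vertices of a member of `SquareClass` form a cycle of order four. -/
theorem SquareClass.isCycle {c : FramedClass (Fin 4)} (hc : SquareClass c) :
    ∀ F : FramedGraph (Fin 4), F.cls = c → Function.Injective F.pt ∧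
      ∀ i j, (cycleGraph 4).Adj i j → F.graph.Adj (F.pt i) (F.pt j) := by
  have key : ∀ F F' : FramedGraph (Fin 4), F.cls = F'.cls → (Function.Injective F'.pt ∧
      ∀ i j, (cycleGraph 4).Adj i j → F'.graph.Adj (F'.pt i) (F'.pt j)) →
      (Function.Injective F.pt ∧
        ∀ i j, (cycleGraph 4).Adj i j → F.graph.Adj (F.pt i) (F.pt j)) := by
    intro F F' h ⟨h1, h2⟩
    obtain ⟨φ, hφ⟩ := cls_eq.1 h
    refine ⟨fun i j hij => h1 ?_, fun i j hij => ?_⟩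
    · rw [← hφ, ← hφ, hij]
    · rw [← φ.map_adj_iff, hφ, hφ]
      exact h2 i j hij
  induction hc with
  | base => exact fun F hF => key F square hF ⟨Function.injective_id, fun _ _ h => h⟩
  | @attach c a i _ _ ih =>
    intro F hF
    induction c using ind with | _ B
    induction a using ind with | _ A
    obtain ⟨h1, h2⟩ := ih B rfl
    exact key F (B.attach i A) hF ⟨Sum.inl_injective.comp h1, h2⟩

theorem SquareClass.isConnected {c : FramedClass (Fin 4)} (hc : SquareClass c) :
    IsConnected c := by
  induction hc with
  | base => exact cycleGraph_connected (n := 3)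
  | attach i _ ha ih => exact isConnected_attach ih ha.isConnected i

theorem order_square : order square.cls = 4 := Fintype.card_fin 4

theorem SquareClass.degreeSum_eq {c : FramedClass (Fin 4)} (hc : SquareClass c) :
    degreeSum c = 2 * order c := by
  induction hc with
  | base =>
    rw [order_square]
    change ∑ x : Fin 4, vdeg (cycleGraph 4) x = 8
    classical
    simp only [vdeg_eq_degree, cycleGraph_degree_three_le (n := 1)]
    rfl
  | @attach c a i _ ha ih =>
    have := order_attach c i a
    have := ha.degreeSum_add_two
    have := ha.order_pos
    rw [degreeSum_attach]
    omega

theorem squareClass_quad {a b c d : FramedClass Unit} (ha : TreeClass a) (hb : TreeClass b)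
    (hc : TreeClass c) (hd : TreeClass d) : SquareClass (quad a b c d) :=
  .attach _ (.attach _ (.attach _ (.attach _ .base ha) hb) hc) hd

theorem leaves_quad (a b c d : FramedClass Unit) :
    leaves (quad a b c d) = leaves a + leaves b + leaves c + leaves d := by
  have : leaves square.cls = 0 :=
    (leaves_cls square (fun _ => False) (fun x => ⟨False.elim, fun h => h.1 x rfl⟩)
      square.fintype).trans (by simp)
  rw [quad, leaves_attach, leaves_attach, leaves_attach, leaves_attach, this, zero_add]

theorem order_quad (a b c d : FramedClass Unit) :
    order (quad a b c d) = order a + order b + order c + order d := by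
  have h1 := order_attach square.cls 0 a
  have h2 := order_attach (square.cls.attach 0 a) 1 b
  have h3 := order_attach ((square.cls.attach 0 a).attach 1 b) 2 c
  have h4 := order_attach (((square.cls.attach 0 a).attach 1 b).attach 2 c) 3 d
  have h5 := order_square
  unfold quad
  omega

end FramedClass

/-- The vertices of a cycle are no leaves, so marking them does not change the number of leaves. -/
theorem ncard_leaves_eq {V : Type} [Fintype V] (G : SimpleGraph V) (f : Fin 4 → V)
    (hinj : Function.Injective f)
    (hf : ∀ i j, (cycleGraph 4).Adj i j → G.Adj (f i) (f j)) :
    {v | vdeg G v = 1}.ncard = leaves (⟨V, G, f⟩ : FramedGraph (Fin 4)).cls := by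
  classical
  have hdeg : ∀ i, vdeg G (f i) ≠ 1 := fun i h => by
    rw [vdeg_eq_degree, degree_eq_one_iff_existsUnique_adj] at h
    obtain ⟨y, -, hy⟩ := h
    have h1 : (cycleGraph 4).Adj i (i + 1) ∧ (cycleGraph 4).Adj i (i + 3) ∧ i + 1 ≠ i + 3 := by
      simp only [cycleGraph_adj]
      fin_cases i <;> decide
    exact h1.2.2 (hinj ((hy _ (hf _ _ h1.1)).trans (hy _ (hf _ _ h1.2.1)).symm))
  rw [leaves_cls ⟨V, G, f⟩ (fun x : V => vdeg G x = 1)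
    (fun x => ⟨fun h => ⟨fun i hi => hdeg i ((congrArg _ hi).trans h), h⟩, fun h => h.2⟩) ‹_›,
    Finset.sum_boole, Set.ncard_eq_toFinset_card']
  simp

open Classical in
theorem sum_vdeg_eq {V : Type*} [Fintype V] (G : SimpleGraph V) :
    ∑ x, vdeg G x = 2 * G.edgeSet.ncard := by
  simp only [vdeg_eq_degree]
  rw [sum_degrees_eq_twice_card_edges, Set.ncard_eq_toFinset_card']
  congr!

open Classical in
/-- Membership in the family of unicyclic graphs of girth four, in terms of attached trees. -/
theorem mem_unicyclicGraphs_iff {n l : ℕ} (G : SimpleGraph (Fin n)) :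
    G ∈ unicyclicGraphs n l 4 ↔ ∃ a b c d, TreeClass a ∧ TreeClass b ∧ TreeClass c ∧
      TreeClass d ∧ ofGraph G = (quad a b c d).bare ∧
      leaves a + leaves b + leaves c + leaves d = l := by
  have hset : {v | G.degree v = 1} = {v | vdeg G v = 1} := by
    ext v; simp only [vdeg_eq_degree]
  constructor
  · rintro ⟨hG, hE, hl, hg⟩
    have hacyc : ¬ G.IsAcyclic := fun h => by rw [h.girth_eq_zero] at hg; omega
    obtain ⟨v, c, hc, hlen⟩ := exists_girth_eq_length.2 hacyc
    obtain ⟨⟨f, hinj⟩⟩ := (cycleGraph_isContained_iff (n := 4) (G := G) (by norm_num)).2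
      ⟨v, c, hc, by omega⟩
    obtain ⟨a, b, c, d, ha, hb, hc, hd, h⟩ := (squareClass_of_connected n (Fin n) G f
      (Fintype.card_fin n) hG (by rw [sum_vdeg_eq, hE]) hinj
      (fun i j h => f.map_adj h)).exists_quad
    refine ⟨a, b, c, d, ha, hb, hc, hd, ?_, ?_⟩
    · rw [← h, bare_cls]
    · rw [← leaves_quad, ← h, ← ncard_leaves_eq G f hinj (fun i j h => f.map_adj h), ← hset, hl]
  · rintro ⟨a, b, c, d, ha, hb, hc, hd, h, hl⟩
    have hs := squareClass_quad ha hb hc hd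
    rw [← leaves_quad] at hl
    generalize quad a b c d = q at *
    induction q using ind with | _ F
    rw [bare_cls, ofGraph_eq_iff] at h
    obtain ⟨φ⟩ := h
    have heq : F.cls = (⟨Fin n, G, φ.symm ∘ F.pt⟩ : FramedGraph (Fin 4)).cls :=
      cls_eq.2 ⟨φ.symm, fun _ => rfl⟩
    obtain ⟨hinj, hf⟩ := hs.isCycle _ heq.symm
    have hconn : G.Connected := φ.connected_iff.2 hs.isConnected
    have hE : G.edgeSet.ncard = n := by
      have h1 : ∑ x, vdeg G x = 2 * n := by
        have := hs.degreeSum_eq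
        rw [heq] at this
        exact this.trans (congrArg _ (Fintype.card_fin n))
      rw [sum_vdeg_eq] at h1
      omega
    refine ⟨hconn, hE, ?_, girth_eq_four hconn (by rw [hE, Fintype.card_fin]) hinj hf⟩
    rw [hset, ncard_leaves_eq G _ hinj hf, ← heq, hl]

/-! ### Polynomials with nonnegative coefficients -/

/-- The polynomials with nonnegative coefficients. -/
def cone : Subsemiring ℝ[X] where
  carrier := {f | ∀ k, 0 ≤ f.coeff k}
  mul_mem' := fun {f g} hf hg k => by
    rw [coeff_mul]
    exact Finset.sum_nonneg fun x _ => mul_nonneg (hf _) (hg _)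
  one_mem' := fun k => by rw [coeff_one]; split_ifs <;> norm_num
  add_mem' := fun {f g} hf hg k => by rw [coeff_add]; exact add_nonneg (hf k) (hg k)
  zero_mem' := fun k => by simp

theorem X_mem_cone : (X : ℝ[X]) ∈ cone := fun k => by rw [coeff_X]; split_ifs <;> norm_num

theorem map_mem_cone (p : ℕ[X]) : p.map (Nat.castRingHom ℝ) ∈ cone := fun k => by simp

/-- Nonzero polynomials with nonnegative coefficients. -/
def Pos (f : ℝ[X]) : Prop := f ∈ cone ∧ f ≠ 0

theorem Pos.eval_pos {f : ℝ[X]} (hf : Pos f) {t : ℝ} (ht : 0 < t) : 0 < f.eval t := by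
  rw [eval_eq_sum]
  refine Finset.sum_pos (fun k hk => mul_pos ?_ (pow_pos ht k)) (by simpa using hf.2)
  exact lt_of_le_of_ne (hf.1 k) (Ne.symm (mem_support_iff.1 hk))

theorem eval_nonneg_of_mem_cone {f : ℝ[X]} (hf : f ∈ cone) {t : ℝ} (ht : 0 < t) :
    0 ≤ f.eval t := by
  by_cases h : f = 0
  · simp [h]
  · exact (Pos.eval_pos ⟨hf, h⟩ ht).le

theorem Pos.add {f g : ℝ[X]} (hf : Pos f) (hg : g ∈ cone) : Pos (f + g) := by
  refine ⟨add_mem hf.1 hg, fun h => ?_⟩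
  have h1 := hf.eval_pos one_pos
  have h2 := eval_nonneg_of_mem_cone hg one_pos
  have h3 := congrArg (eval 1) h
  rw [eval_add, eval_zero] at h3
  linarith

theorem Pos.add' {f g : ℝ[X]} (hf : f ∈ cone) (hg : Pos g) : Pos (f + g) :=
  add_comm g f ▸ hg.add hf

theorem Pos.mul {f g : ℝ[X]} (hf : Pos f) (hg : Pos g) : Pos (f * g) :=
  ⟨mul_mem hf.1 hg.1, mul_ne_zero hf.2 hg.2⟩

theorem Pos.X : Pos (X : ℝ[X]) := ⟨X_mem_cone, X_ne_zero⟩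

theorem Pos.one : Pos (1 : ℝ[X]) := ⟨one_mem _, one_ne_zero⟩

/-- A criterion that reduces explicit polynomials to polynomials with natural coefficients. -/
theorem pos_map {f : ℝ[X]} (p : ℕ[X]) (h : p.map (Nat.castRingHom ℝ) = f)
    (h1 : f.eval 1 ≠ 0) : Pos f :=
  ⟨h ▸ map_mem_cone p, fun h2 => h1 (by rw [h2, eval_zero])⟩

namespace FramedClass

/-! ### The comparison of rooted graphs -/

theorem TreeClass.pos_Q_R {a} (h : TreeClass a) : Pos a.Q ∧ a.R ∈ cone ∧ (a = 1 ∨ Pos a.R) := by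
  induction h with
  | one => exact ⟨by rw [Q_one]; exact .one, by rw [R_one]; exact zero_mem _, .inl rfl⟩
  | ext _ ih =>
    rw [Q_ext, R_ext]
    have h1 : Pos (X * (Q _ + R _)) := Pos.X.mul (ih.1.add ih.2.1)
    exact ⟨(Pos.mul (Pos.one.add X_mem_cone) ih.1).add ih.2.1, h1.1, .inr h1⟩
  | @mul a b _ _ iha ihb =>
    rw [Q_mul, R_mul]
    refine ⟨iha.1.mul ihb.1, add_mem (mul_mem iha.1.1 ihb.2.1) (mul_mem iha.2.1 ihb.1.1), ?_⟩
    rcases iha.2.2 with rfl | ha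
    · rw [one_mul, Q_one, R_one, one_mul, zero_mul, add_zero]
      exact ihb.2.2
    · exact .inr (Pos.add' (mul_mem iha.1.1 ihb.2.1) (ha.mul ihb.1))

theorem TreeClass.pos_Q {a} (h : TreeClass a) : Pos a.Q := h.pos_Q_R.1

theorem TreeClass.R_mem {a} (h : TreeClass a) : a.R ∈ cone := h.pos_Q_R.2.1

theorem TreeClass.pos_R {a} (h : TreeClass a) (h1 : a ≠ 1) : Pos a.R :=
  h.pos_Q_R.2.2.resolve_left h1

theorem TreeClass.rootDegree_pos {a} (h : TreeClass a) (h1 : a ≠ 1) : 0 < rootDegree a :=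
  (h.eq_one_or.resolve_left h1).2

theorem TreeClass.iterate {a} (h : TreeClass a) (d : ℕ) : TreeClass (FramedClass.ext^[d] a) := by
  induction d with
  | zero => exact h
  | succ d ih => rw [Function.iterate_succ_apply']; exact .ext ih

theorem order_iterate (a : FramedClass Unit) (d : ℕ) : order (ext^[d] a) = order a + d := by
  induction d with
  | zero => rfl
  | succ d ih => rw [Function.iterate_succ_apply', order_ext, ih, add_assoc]

theorem leaves_iterate {a : FramedClass Unit} (h : 0 < rootDegree a) (d : ℕ) :
    leaves (ext^[d] a) = leaves a ∧ 0 < rootDegree (ext^[d] a) := by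
  induction d with
  | zero => exact ⟨rfl, h⟩
  | succ d ih =>
    rw [Function.iterate_succ_apply', leaves_ext, if_neg ih.2.ne', ih.1, rootDegree_ext]
    exact ⟨rfl, one_pos⟩

/-- The effect of `d` extensions on `Q` and `R`. -/
theorem exists_iterate_eq (d : ℕ) : ∃ β δ : ℝ[X], β ∈ cone ∧ δ ∈ cone ∧ Pos (β + δ) ∧
    (0 < d → Pos β) ∧ ∀ a, Q (ext^[d] a) = (β + δ) * a.Q + β * a.R ∧
      R (ext^[d] a) = X * β * a.Q + δ * a.R := by
  induction d with
  | zero => exact ⟨0, 1, zero_mem _, one_mem _, by rw [zero_add]; exact .one, by simp, by simp⟩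
  | succ d ih =>
    obtain ⟨β, δ, hβ, hδ, h, -, ha⟩ := ih
    have h1 : Pos (β + δ + X * β) := h.add (mul_mem X_mem_cone hβ)
    have h2 : X * (β + δ) ∈ cone := mul_mem X_mem_cone h.1
    refine ⟨β + δ + X * β, X * (β + δ), h1.1, h2, h1.add h2, fun _ => h1, fun a => ?_⟩
    rw [Function.iterate_succ_apply', Q_ext, R_ext, (ha a).1, (ha a).2]
    constructor <;> ring

/-- `D a b` is the cross difference of the quotients `R / Q` of `a` and `b`; it has nonnegative
coefficients if `a` is heavier than `b`. -/
noncomputable def D (a b : FramedClass Unit) : ℝ[X] := b.Q * a.R - a.Q * b.R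

theorem D_one (a : FramedClass Unit) : D a 1 = a.R := by rw [D, Q_one, R_one]; ring

theorem D_ext_ext (a b : FramedClass Unit) : D a.ext b.ext = X ^ 2 * D a b := by
  simp only [D, Q_ext, R_ext]; ring

/-- Attaching anything to its root makes a rooted tree heavier. -/
theorem D_mul (a y b : FramedClass Unit) : D (a * y) b = y.Q * D a b + b.Q * a.Q * y.R := by
  simp only [D, Q_mul, R_mul]; ring

theorem path_succ (k : ℕ) : path (k + 1) = (path k).ext := Function.iterate_succ_apply' _ _ _

theorem path_zero : path 0 = 1 := rfl

theorem treeClass_path (k : ℕ) : TreeClass (path k) := TreeClass.one.iterate k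

theorem order_path (k : ℕ) : order (path k) = k + 1 := by
  rw [path, order_iterate, order_one, add_comm]

theorem ne_one_of_rootDegree {a : FramedClass Unit} (h : 0 < rootDegree a) : a ≠ 1 := by
  rintro rfl
  rw [rootDegree_one] at h
  exact h.false

theorem rootDegree_path {k : ℕ} (hk : 1 ≤ k) : rootDegree (path k) = 1 := by
  obtain ⟨k, rfl⟩ := Nat.exists_eq_add_of_le' hk
  rw [path_succ, rootDegree_ext]

theorem path_ne_one {k : ℕ} (hk : 1 ≤ k) : path k ≠ 1 :=
  ne_one_of_rootDegree (by rw [rootDegree_path hk]; exact one_pos)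

theorem leaves_path {k : ℕ} (hk : 1 ≤ k) : leaves (path k) = 1 := by
  obtain ⟨k, rfl⟩ := Nat.exists_eq_add_of_le' hk
  rw [path, Function.iterate_succ_apply, (leaves_iterate (by rw [rootDegree_ext]; exact one_pos)
    k).1, leaves_ext, leaves_one, rootDegree_one, if_pos rfl]

theorem D_path_path (j m : ℕ) : D (path (m + j)) (path j) = X ^ (2 * j) * R (path m) := by
  induction j with
  | zero => rw [path_zero, D_one]; simp
  | succ j ih => rw [← add_assoc, path_succ, path_succ, D_ext_ext, ih]; ring

/-- `a` is heavier than all paths with at most `k` edges. -/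
def Dominates (a : FramedClass Unit) (k : ℕ) : Prop := ∀ b ≤ k, D a (path b) ∈ cone

theorem dominates_one : Dominates 1 0 := by
  intro b hb
  rw [Nat.le_zero.1 hb, path_zero, D_one, R_one]
  exact zero_mem _

theorem Dominates.mul {a y : FramedClass Unit} {k : ℕ} (h : Dominates a k) (ha : TreeClass a)
    (hy : TreeClass y) : Dominates (a * y) k := by
  intro b hb
  rw [D_mul]
  exact add_mem (mul_mem hy.pos_Q.1 (h b hb))
    (mul_mem (mul_mem (treeClass_path b).pos_Q.1 ha.pos_Q.1) hy.R_mem)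

theorem Dominates.ext {a : FramedClass Unit} {k : ℕ} (h : Dominates a k) (ha : TreeClass a) :
    Dominates a.ext (k + 1) := by
  rintro (_ | b) hb
  · rw [path_zero, D_one]
    exact ha.ext.R_mem
  · rw [path_succ, D_ext_ext]
    exact mul_mem (pow_mem X_mem_cone 2) (h b (by omega))

theorem Dominates.iterate {a : FramedClass Unit} {k : ℕ} (h : Dominates a k) (ha : TreeClass a)
    (d : ℕ) : Dominates (FramedClass.ext^[d] a) (k + d) := by
  induction d with
  | zero => exact h
  | succ d ih =>
    rw [Function.iterate_succ_apply', ← add_assoc]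
    exact ih.ext (ha.iterate d)

theorem dominates_path (k : ℕ) : Dominates (path k) k := by
  have := dominates_one.iterate .one k
  rwa [zero_add] at this

/-- `a'` has as many vertices and leaves as `a`, and replacing `a` by `a'` decreases the Laplacian
coefficients of every graph to which `a` is attached. -/
def Below (a' a : FramedClass Unit) : Prop :=
  order a' = order a ∧ leaves a' = leaves a ∧ a.Q - a'.Q ∈ cone ∧ a.P - a'.P ∈ cone ∧
    ¬ (a.Q - a'.Q = 0 ∧ a.P - a'.P = 0)

/-- Some rooted tree is below `a`. -/
def Reducible (a : FramedClass Unit) : Prop := ∃ a', TreeClass a' ∧ Below a' a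

theorem Below.mul {a' a b : FramedClass Unit} (h : Below a' a) (hb : TreeClass b) :
    Below (a' * b) (a * b) := by
  obtain ⟨h1, h2, h3, h4, h5⟩ := h
  have hP : P (a * b) - P (a' * b) = b.Q * (a.P - a'.P) + b.R * (a.Q - a'.Q) := by
    rw [P_mul, P_mul]; ring
  have hQ : Q (a * b) - Q (a' * b) = b.Q * (a.Q - a'.Q) := by
    rw [Q_mul, Q_mul]; ring
  refine ⟨?_, by rw [leaves_mul, leaves_mul, h2], ?_, ?_, ?_⟩
  · have := order_mul a b
    have := order_mul a' b
    omega
  · rw [hQ]; exact mul_mem hb.pos_Q.1 h3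
  · rw [hP]; exact add_mem (mul_mem hb.pos_Q.1 h4) (mul_mem hb.R_mem h3)
  · rw [hQ, hP]
    rintro ⟨h6, h7⟩
    have h8 := (mul_eq_zero.1 h6).resolve_left hb.pos_Q.2
    rw [h8, mul_zero, add_zero] at h7
    exact h5 ⟨h8, (mul_eq_zero.1 h7).resolve_left hb.pos_Q.2⟩

theorem Reducible.mul {a b : FramedClass Unit} (h : Reducible a) (hb : TreeClass b) :
    Reducible (a * b) :=
  let ⟨a', ha', h'⟩ := h
  ⟨a' * b, .mul ha' hb, h'.mul hb⟩

theorem TreeClass.rootDegree_eq_zero_iff {a} (h : TreeClass a) :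
    rootDegree a = 0 ↔ order a = 1 := by
  rcases h.eq_one_or with rfl | h'
  · simp [rootDegree_one, order_one]
  · omega

theorem Reducible.ext {a : FramedClass Unit} (h : Reducible a) (ha : TreeClass a) :
    Reducible a.ext := by
  obtain ⟨a', ha', h1, h2, h3, h4, h5⟩ := h
  have hQ : a.ext.Q - a'.ext.Q = (a.P - a'.P) + X * (a.Q - a'.Q) := by
    rw [Q_ext, Q_ext, P_eq, P_eq]; ring
  have hP : a.ext.P - a'.ext.P = (1 + X) * (a.P - a'.P) + X * (a.Q - a'.Q) := by
    rw [P_ext, P_ext, P_eq, P_eq]; ring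
  refine ⟨a'.ext, ha'.ext, by rw [order_ext, order_ext, h1], ?_, ?_, ?_, ?_⟩
  · simp only [leaves_ext, h2, ha.rootDegree_eq_zero_iff, ha'.rootDegree_eq_zero_iff, h1]
  · rw [hQ]; exact add_mem h4 (mul_mem X_mem_cone h3)
  · rw [hP]
    exact add_mem (mul_mem (add_mem (one_mem _) X_mem_cone) h4) (mul_mem X_mem_cone h3)
  · rw [hQ, hP]
    rintro ⟨h6, h7⟩
    have h8 : X * (a.P - a'.P) = 0 := by linear_combination h7 - h6
    have h9 := (mul_eq_zero.1 h8).resolve_left X_ne_zero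
    rw [h9, zero_add] at h6
    exact h5 ⟨(mul_eq_zero.1 h6).resolve_left X_ne_zero, h9⟩

theorem Reducible.iterate {a : FramedClass Unit} (h : Reducible a) (ha : TreeClass a) (d : ℕ) :
    Reducible (FramedClass.ext^[d] a) := by
  induction d with
  | zero => exact h
  | succ d ih => rw [Function.iterate_succ_apply']; exact ih.ext (ha.iterate d)

/-- If the part `a` at one branching vertex is heavier than `p`, then all branches `x` next to `p`
can be moved to that vertex. -/
theorem reducible_of_heavier_root {a p x : FramedClass Unit} (ha : TreeClass a) (hp : TreeClass p)
    (hx : TreeClass x) (hD : D a p ∈ cone) (hp1 : p ≠ 1) (hx1 : x ≠ 1) {d : ℕ} (hd : 0 < d) :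
    Reducible (a * ext^[d] (p * x)) := by
  obtain ⟨β, δ, hβ, hδ, -, hpos, h⟩ := exists_iterate_eq d
  have hQ : Q (a * ext^[d] (p * x)) - Q (a * x * ext^[d] p) = x.R * β * a.Q * p.Q := by
    simp only [Q_mul, h, R_mul]; ring
  have hP : P (a * ext^[d] (p * x)) - P (a * x * ext^[d] p) = x.R * β * D a p := by
    simp only [P_eq, Q_mul, R_mul, h, D]; ring
  have hxR := hx.pos_R hx1
  have hpx : 0 < rootDegree (p * x) := by
    rw [rootDegree_mul]; have := hp.rootDegree_pos hp1; omega
  refine ⟨a * x * ext^[d] p, .mul (.mul ha hx) (hp.iterate d), ?_, ?_, ?_, ?_, ?_⟩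
  · have h1 := order_mul (a * x) (ext^[d] p)
    have h2 := order_mul a x
    have h3 := order_mul a (ext^[d] (p * x))
    have h4 := order_mul p x
    rw [order_iterate] at h1 h3
    omega
  · rw [leaves_mul, leaves_mul, leaves_mul, (leaves_iterate hpx d).1,
      (leaves_iterate (hp.rootDegree_pos hp1) d).1, leaves_mul]
    ring
  · rw [hQ]
    exact mul_mem (mul_mem (mul_mem hxR.1 hβ) ha.pos_Q.1) hp.pos_Q.1
  · rw [hP]
    exact mul_mem (mul_mem hxR.1 hβ) hD
  · rw [hQ]
    exact fun h => (((hxR.mul (hpos hd)).mul ha.pos_Q).mul hp.pos_Q).2 h.1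

/-- If the part `b` at one branching vertex is heavier than `p`, then everything next to `p` can
be moved to that vertex, including the graph to which the tree is attached. -/
theorem reducible_of_heavier_branch {p y b : FramedClass Unit} (hp : TreeClass p)
    (hy : TreeClass y) (hb : TreeClass b) (hD : Pos (D b p)) (hp1 : p ≠ 1) (hb1 : b ≠ 1) {d : ℕ}
    (hd : 0 < d) : Reducible (p * y * ext^[d] b) := by
  obtain ⟨β, δ, hβ, hδ, -, hpos, h⟩ := exists_iterate_eq d
  have hQ : Q (p * y * ext^[d] b) - Q (y * b * ext^[d] p) = y.Q * β * D b p := by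
    simp only [Q_mul, h, D]; ring
  have hP : P (p * y * ext^[d] b) - P (y * b * ext^[d] p) = y.R * β * D b p := by
    simp only [P_eq, Q_mul, R_mul, h, D]; ring
  refine ⟨y * b * ext^[d] p, .mul (.mul hy hb) (hp.iterate d), ?_, ?_, ?_, ?_, ?_⟩
  · have h1 := order_mul (y * b) (ext^[d] p)
    have h2 := order_mul y b
    have h3 := order_mul (p * y) (ext^[d] b)
    have h4 := order_mul p y
    rw [order_iterate] at h1 h3
    omega
  · rw [leaves_mul, leaves_mul, leaves_mul, leaves_mul,
      (leaves_iterate (hb.rootDegree_pos hb1) d).1, (leaves_iterate (hp.rootDegree_pos hp1) d).1]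
    ring
  · rw [hQ]
    exact mul_mem (mul_mem hy.pos_Q.1 hβ) hD.1
  · rw [hP]
    exact mul_mem (mul_mem hy.R_mem hβ) hD.1
  · rw [hQ]
    exact fun h => ((hy.pos_Q.mul (hpos hd)).mul hD).2 h.1

/-- Balancing: an edge is moved from the branch over `a` to the lighter branch `b`. -/
theorem reducible_ext_mul {a b : FramedClass Unit} (ha : TreeClass a) (hb : TreeClass b)
    (hD : Pos (D a b)) (ha1 : a ≠ 1) (hb1 : b ≠ 1) : Reducible (a.ext * b) := by
  have hQ : Q (a.ext * b) - Q (a * b.ext) = D a b := by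
    simp only [Q_mul, Q_ext, D]; ring
  have hP : P (a.ext * b) - P (a * b.ext) = 0 := by
    simp only [P_eq, Q_mul, R_mul, Q_ext, R_ext]; ring
  refine ⟨a * b.ext, .mul ha hb.ext, ?_, ?_, ?_, ?_, ?_⟩
  · have h1 := order_mul a.ext b
    have h2 := order_mul a b.ext
    rw [order_ext] at h1 h2
    omega
  · rw [leaves_mul, leaves_mul, leaves_ext, leaves_ext, if_neg (ha.rootDegree_pos ha1).ne',
      if_neg (hb.rootDegree_pos hb1).ne']
    rfl
  · rw [hQ]; exact hD.1
  · rw [hP]; exact zero_mem _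
  · rw [hQ]; exact fun h => hD.2 h.1

/-! ### Irreducible rooted trees -/

/-- Paths with the given numbers of edges, identified at one end. -/
noncomputable def bouquet (s : Multiset ℕ) : FramedClass Unit := (s.map path).prod

theorem bouquet_zero : bouquet 0 = 1 := by simp [bouquet]

theorem bouquet_cons (k : ℕ) (s : Multiset ℕ) : bouquet (k ::ₘ s) = path k * bouquet s := by
  simp [bouquet]

theorem bouquet_add (s t : Multiset ℕ) : bouquet (s + t) = bouquet s * bouquet t := by
  simp [bouquet]

theorem treeClass_bouquet (s : Multiset ℕ) : TreeClass (bouquet s) := by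
  induction s using Multiset.induction with
  | empty => rw [bouquet_zero]; exact .one
  | cons k s ih => rw [bouquet_cons]; exact .mul (treeClass_path k) ih

theorem order_bouquet (s : Multiset ℕ) : order (bouquet s) = s.sum + 1 := by
  induction s using Multiset.induction with
  | empty => rw [bouquet_zero, order_one]; rfl
  | cons k s ih =>
    have := order_mul (path k) (bouquet s)
    rw [order_path] at this
    rw [bouquet_cons, Multiset.sum_cons]
    omega

theorem leaves_bouquet {s : Multiset ℕ} (hs : ∀ k ∈ s, 1 ≤ k) :
    leaves (bouquet s) = Multiset.card s ∧ rootDegree (bouquet s) = Multiset.card s := by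
  induction s using Multiset.induction with
  | empty => rw [bouquet_zero, leaves_one, rootDegree_one]; exact ⟨rfl, rfl⟩
  | cons k s ih =>
    have hk := hs k (Multiset.mem_cons_self _ _)
    have ih := ih fun j hj => hs j (Multiset.mem_cons_of_mem hj)
    rw [bouquet_cons, leaves_mul, rootDegree_mul, leaves_path hk, rootDegree_path hk, ih.1, ih.2,
      Multiset.card_cons]
    omega

theorem bouquet_ne_one {s : Multiset ℕ} (hs : ∀ k ∈ s, 1 ≤ k) (h : 1 ≤ Multiset.card s) :
    bouquet s ≠ 1 :=
  ne_one_of_rootDegree (by rw [(leaves_bouquet hs).2]; exact h)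

theorem bouquet_singleton (k : ℕ) : bouquet {k} = path k := by simp [bouquet]

/-- A bouquet meeting a second branching vertex is reducible: of two legs, one at each branching
vertex, the shorter one is kept and everything else at its end is moved. -/
theorem reducible_bouquet_mul {s t : Multiset ℕ} (hs : ∀ k ∈ s, 1 ≤ k) (ht : ∀ k ∈ t, 1 ≤ k)
    (hs1 : 1 ≤ Multiset.card s) (ht2 : 2 ≤ Multiset.card t) {d : ℕ} (hd : 0 < d) :
    Reducible (bouquet s * ext^[d] (bouquet t)) := by
  obtain ⟨a, ha⟩ := Multiset.card_pos_iff_exists_mem.1 hs1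
  obtain ⟨b, hb⟩ := Multiset.card_pos_iff_exists_mem.1 (by omega : 0 < Multiset.card t)
  obtain ⟨s, rfl⟩ := Multiset.exists_cons_of_mem ha
  obtain ⟨t, rfl⟩ := Multiset.exists_cons_of_mem hb
  have ha1 := hs a ha
  have hb1 := ht b hb
  have htt : bouquet t ≠ 1 := bouquet_ne_one (fun k hk => ht k (Multiset.mem_cons_of_mem hk))
    (by rw [Multiset.card_cons] at ht2; omega)
  have htR := (treeClass_bouquet t).pos_R htt
  by_cases hab : a ≤ b
  · have h1 : Pos (D (bouquet (b ::ₘ t)) (path a)) := by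
      rw [bouquet_cons, D_mul]
      exact Pos.add' (mul_mem (treeClass_bouquet t).pos_Q.1 (dominates_path b a hab))
        (((treeClass_path a).pos_Q.mul (treeClass_path b).pos_Q).mul htR)
    rw [bouquet_cons a s]
    exact reducible_of_heavier_branch (treeClass_path a) (treeClass_bouquet s)
      (treeClass_bouquet _) h1 (path_ne_one ha1) (bouquet_ne_one ht (by omega)) hd
  · rw [bouquet_cons b t]
    refine reducible_of_heavier_root (treeClass_bouquet _) (treeClass_path b)
      (treeClass_bouquet t) ?_ (path_ne_one hb1) htt hd
    rw [bouquet_cons]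
    exact (dominates_path a).mul (treeClass_path a) (treeClass_bouquet s) b (by omega)

/-- An irreducible rooted tree is a bouquet at the end of a path: two branching vertices allow one
of the moves above. -/
theorem TreeClass.exists_bouquet {a : FramedClass Unit} (h : TreeClass a) (hr : ¬ Reducible a) :
    ∃ (d : ℕ) (s : Multiset ℕ), (∀ k ∈ s, 1 ≤ k) ∧ (0 < d → 2 ≤ Multiset.card s) ∧
      a = FramedClass.ext^[d] (bouquet s) := by
  induction h with
  | one => exact ⟨0, 0, by simp, by simp, by simp [bouquet]⟩
  | @ext a ha ih =>
    obtain ⟨d, s, hs, hd, rfl⟩ := ih fun h => hr (h.ext ha)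
    by_cases h2 : 2 ≤ Multiset.card s
    · exact ⟨d + 1, s, hs, fun _ => h2, (Function.iterate_succ_apply' _ _ _).symm⟩
    · have hd0 : d = 0 := by by_contra h; exact h2 (hd (by omega))
      subst hd0
      rcases (by omega : Multiset.card s = 0 ∨ Multiset.card s = 1) with h0 | h1
      · rw [Multiset.card_eq_zero.1 h0]
        refine ⟨0, {1}, by simp, by simp, ?_⟩
        rw [Function.iterate_zero_apply, Function.iterate_zero_apply, bouquet_zero,
          bouquet_singleton]
        rfl
      · obtain ⟨k, rfl⟩ := Multiset.card_eq_one.1 h1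
        refine ⟨0, {k + 1}, by simp, by simp, ?_⟩
        rw [Function.iterate_zero_apply, Function.iterate_zero_apply, bouquet_singleton,
          bouquet_singleton, path_succ]
  | @mul a b ha hb iha ihb =>
    obtain ⟨d, s, hs, hd, rfl⟩ := iha fun h => hr (h.mul hb)
    obtain ⟨e, t, ht, he, rfl⟩ := ihb fun h => hr (by rw [mul_comm]; exact h.mul ha)
    rcases Nat.eq_zero_or_pos d with rfl | hd0
    · rcases Nat.eq_zero_or_pos e with rfl | he0
      · refine ⟨0, s + t, ?_, by simp, (bouquet_add s t).symm⟩
        intro k hk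
        rcases Multiset.mem_add.1 hk with h | h
        exacts [hs k h, ht k h]
      · rcases Nat.eq_zero_or_pos (Multiset.card s) with h0 | h0
        · rw [Multiset.card_eq_zero.1 h0]
          exact ⟨e, t, ht, he, by simp [bouquet]⟩
        · exact (hr (reducible_bouquet_mul hs ht h0 (he he0) he0)).elim
    · rcases Nat.eq_zero_or_pos e with rfl | he0
      · rcases Nat.eq_zero_or_pos (Multiset.card t) with h0 | h0
        · rw [Multiset.card_eq_zero.1 h0]
          exact ⟨d, s, hs, hd, by simp [bouquet]⟩
        · rw [mul_comm] at hr
          exact (hr (reducible_bouquet_mul ht hs h0 (hd hd0) hd0)).elim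
      · -- both trees have a branching vertex below the root
        have key : ∀ {s t : Multiset ℕ} {d e : ℕ} {i j : ℕ}, (∀ k ∈ s, 1 ≤ k) →
            (∀ k ∈ t, 1 ≤ k) → 2 ≤ Multiset.card s → 0 < d → i ∈ s → j ∈ t → i ≤ j →
            Reducible (FramedClass.ext^[e] (bouquet t) * FramedClass.ext^[d] (bouquet s)) := by
          intro s t d e i j hs ht h2 hd hi hj hij
          obtain ⟨s, rfl⟩ := Multiset.exists_cons_of_mem hi
          obtain ⟨t, rfl⟩ := Multiset.exists_cons_of_mem hj
          rw [bouquet_cons i]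
          refine reducible_of_heavier_root ((treeClass_bouquet _).iterate e) (treeClass_path i)
            (treeClass_bouquet s) ?_ (path_ne_one (hs i hi)) (bouquet_ne_one
              (fun k hk => hs k (Multiset.mem_cons_of_mem hk))
              (by rw [Multiset.card_cons] at h2; omega)) hd
          have h1 := ((dominates_path j).mul (treeClass_path j) (treeClass_bouquet t)).iterate
            (.mul (treeClass_path j) (treeClass_bouquet t)) e
          rw [bouquet_cons]
          exact h1 i (by omega)
        obtain ⟨i, hi⟩ := Multiset.card_pos_iff_exists_mem.1
          (by have := hd hd0; omega : 0 < Multiset.card s)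
        obtain ⟨j, hj⟩ := Multiset.card_pos_iff_exists_mem.1
          (by have := he he0; omega : 0 < Multiset.card t)
        rcases le_total i j with hij | hij
        · rw [mul_comm] at hr
          exact (hr (key hs ht (hd hd0) hd0 hi hj hij)).elim
        · exact (hr (key ht hs (he he0) he0 hj hi hij)).elim

/-- A bouquet with two legs whose lengths differ by at least two is reducible. -/
theorem reducible_bouquet {s : Multiset ℕ} (hs : ∀ k ∈ s, 1 ≤ k) {i j : ℕ} (hi : i ∈ s)
    (hj : j ∈ s) (hij : j + 2 ≤ i) : Reducible (bouquet s) := by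
  obtain ⟨s, rfl⟩ := Multiset.exists_cons_of_mem hi
  have hj' : j ∈ s := (Multiset.mem_cons.1 hj).resolve_left (by omega)
  obtain ⟨s, rfl⟩ := Multiset.exists_cons_of_mem hj'
  have hj1 := hs j hj
  obtain ⟨m, rfl⟩ : ∃ m, i = m + j + 1 := ⟨i - j - 1, by omega⟩
  rw [bouquet_cons, bouquet_cons, ← mul_assoc, path_succ]
  refine (reducible_ext_mul (treeClass_path _) (treeClass_path j) ?_ (path_ne_one (by omega))
    (path_ne_one hj1)).mul (treeClass_bouquet s)
  rw [D_path_path]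
  have hX : Pos (X ^ (2 * j) : ℝ[X]) := ⟨pow_mem X_mem_cone _, pow_ne_zero _ X_ne_zero⟩
  exact hX.mul ((treeClass_path m).pos_R (path_ne_one (by omega)))

/-! ### Graphs with one attached tree -/

theorem squareRoot_mul (t : FramedClass Unit) :
    squareRoot * t = (quad t 1 1 1).reframe fun _ => 0 := by
  rw [quad, attach_one, attach_one, attach_one]
  exact (reframe_attach square.cls (fun _ => 0) () t).symm

theorem P_squareRoot_mul (t : FramedClass Unit) : P (squareRoot * t) =
    (1 + 8 * X + 20 * X ^ 2 + 16 * X ^ 3) * t.Q + (1 + 6 * X + 10 * X ^ 2 + 4 * X ^ 3) * t.R := by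
  rw [squareRoot_mul, P_reframe, P_quad, Q_one, R_one]
  ring

theorem Q_squareRoot : Q squareRoot = 1 + 6 * X + 10 * X ^ 2 + 4 * X ^ 3 := by
  have h0 := P_squareRoot_mul 1
  have h1 := P_squareRoot_mul (ext 1)
  rw [P_mul, Q_ext, R_ext] at h1
  rw [mul_one] at h0
  rw [Q_one, R_one] at h0 h1
  refine mul_left_cancel₀ X_ne_zero (?_ : X * _ = X * _)
  linear_combination h1 - (1 + X) * h0

theorem R_squareRoot : R squareRoot = 2 * X + 10 * X ^ 2 + 12 * X ^ 3 := by
  have h := P_squareRoot_mul 1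
  rw [mul_one, P_eq, Q_squareRoot, Q_one, R_one] at h
  linear_combination h

theorem pos_Q_squareRoot : Pos (Q squareRoot) :=
  pos_map (1 + 6 * X + 10 * X ^ 2 + 4 * X ^ 3) (by simp [Q_squareRoot])
    (by rw [Q_squareRoot]; norm_num)

theorem pos_R_squareRoot : Pos (R squareRoot) :=
  pos_map (2 * X + 10 * X ^ 2 + 12 * X ^ 3) (by simp [R_squareRoot])
    (by rw [R_squareRoot]; norm_num)

theorem pos_R_iterate_squareRoot (j : ℕ) : Pos (R (ext^[j] squareRoot)) := by
  obtain ⟨β, δ, hβ, hδ, h, -, hj⟩ := exists_iterate_eq j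
  rw [(hj _).2]
  refine ⟨add_mem (mul_mem (mul_mem X_mem_cone hβ) pos_Q_squareRoot.1)
    (mul_mem hδ pos_R_squareRoot.1), fun h0 => ?_⟩
  have h1 := congrArg (eval 1) h0
  have h2 := h.eval_pos one_pos
  have h3 := eval_nonneg_of_mem_cone hβ one_pos
  have h4 := eval_nonneg_of_mem_cone hδ one_pos
  rw [Q_squareRoot, R_squareRoot] at h1
  norm_num at h1 h2
  linarith

theorem D_iterate_add (a b : FramedClass Unit) (j : ℕ) :
    D (ext^[j] a) (ext^[j] b) = X ^ (2 * j) * D a b := by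
  induction j with
  | zero => simp
  | succ j ih =>
    rw [Function.iterate_succ_apply', Function.iterate_succ_apply', D_ext_ext, ih]
    ring

theorem path_add (j k : ℕ) : path (j + k) = ext^[j] (path k) := Function.iterate_add_apply _ _ _ _

theorem Q_path_succ (k : ℕ) : Q (path (k + 1)) = (1 + X) * Q (path k) + R (path k) := by
  rw [path_succ, Q_ext]

theorem R_path_succ (k : ℕ) : R (path (k + 1)) = X * (Q (path k) + R (path k)) := by
  rw [path_succ, R_ext]

/-- The rooted square is heavier than the paths with at most three edges; with `j` further edges
at the root, the bound rises by `j`. -/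
theorem pos_D_iterate_squareRoot {j k : ℕ} (hk : k ≤ j + 3) :
    Pos (D (ext^[j] squareRoot) (path k)) := by
  have hX : ∀ j, Pos (X ^ (2 * j) : ℝ[X]) :=
    fun j => ⟨pow_mem X_mem_cone _, pow_ne_zero _ X_ne_zero⟩
  rcases le_total k j with h | h
  · obtain ⟨m, rfl⟩ := Nat.exists_eq_add_of_le h
    rw [Function.iterate_add_apply, path, D_iterate_add, D_one]
    exact (hX k).mul (pos_R_iterate_squareRoot m)
  · obtain ⟨m, rfl⟩ := Nat.exists_eq_add_of_le h
    rw [path_add, D_iterate_add]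
    refine (hX j).mul ?_
    have hm : m ≤ 3 := by omega
    interval_cases m
    · rw [path_zero, D_one]
      exact pos_R_squareRoot
    · refine pos_map (X + 6 * X ^ 2 + 12 * X ^ 3 + 8 * X ^ 4) ?_ ?_
      · simp [D, Q_path_succ, R_path_succ, path_zero, Q_one, R_one, Q_squareRoot, R_squareRoot]
        ring
      · simp [D, Q_path_succ, R_path_succ, path_zero, Q_one, R_one, Q_squareRoot, R_squareRoot]
        norm_num
    · refine pos_map (X + 8 * X ^ 2 + 22 * X ^ 3 + 22 * X ^ 4 + 4 * X ^ 5) ?_ ?_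
      · simp [D, Q_path_succ, R_path_succ, path_zero, Q_one, R_one, Q_squareRoot, R_squareRoot]
        ring
      · simp [D, Q_path_succ, R_path_succ, path_zero, Q_one, R_one, Q_squareRoot, R_squareRoot]
        norm_num
    · refine pos_map (X + 10 * X ^ 2 + 37 * X ^ 3 + 60 * X ^ 4 + 36 * X ^ 5) ?_ ?_
      · simp [D, Q_path_succ, R_path_succ, path_zero, Q_one, R_one, Q_squareRoot, R_squareRoot]
        ring
      · simp [D, Q_path_succ, R_path_succ, path_zero, Q_one, R_one, Q_squareRoot, R_squareRoot]
        norm_num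

theorem P_mul_ext (a b : FramedClass Unit) : P (a * b.ext) = P (a.ext * b) := by
  simp only [P_eq, Q_mul, R_mul, Q_ext, R_ext]
  ring

/-- An edge between two rooted graphs can be assigned to either of them. -/
theorem P_mul_iterate (a b : FramedClass Unit) (i : ℕ) : P (a * ext^[i] b) = P (ext^[i] a * b) := by
  induction i generalizing b with
  | zero => rfl
  | succ i ih =>
    rw [Function.iterate_succ_apply, ih, P_mul_ext, ← Function.iterate_succ_apply' (f := ext)]

/-- The effect of moving an edge from the connection between `a` and the branching vertex to the
branch `p`. -/
theorem P_sub_P (a p x : FramedClass Unit) (i : ℕ) :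
    P (a * ext^[i + 1] (p * x)) - P (a * ext^[i] (p.ext * x)) = R x * D (ext^[i] a) p := by
  rw [P_mul_iterate, P_mul_iterate, Function.iterate_succ_apply']
  simp only [P_eq, Q_mul, R_mul, Q_ext, R_ext, D]
  ring

/-! ### Reduction to one attached tree -/

/-- The unicyclic graphs with `n` vertices and `l` leaves that contain a cycle of order four, up to
isomorphism, given by the trees attached to the cycle. -/
def squareGraphs (n l : ℕ) : Set (FramedClass Empty) :=
  {g | ∃ a b c d, TreeClass a ∧ TreeClass b ∧ TreeClass c ∧ TreeClass d ∧
    g = (quad a b c d).bare ∧ order a + order b + order c + order d = n ∧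
    leaves a + leaves b + leaves c + leaves d = l}

/-- Some graph in the family has strictly smaller Laplacian coefficients than `g`. -/
def Improvable (n l : ℕ) (g : FramedClass Empty) : Prop :=
  ∃ g' ∈ squareGraphs n l, Pos (P g - P g')

theorem square_reframe : square.cls.reframe (· + 1) = square.cls := by
  let φ : cycleGraph 4 ≃g cycleGraph 4 := ⟨Equiv.subRight (1 : Fin 4), by
    intro i j
    rw [Equiv.subRight_apply, Equiv.subRight_apply, cycleGraph_adj, cycleGraph_adj,
      sub_sub_sub_cancel_right, sub_sub_sub_cancel_right]⟩
  exact cls_eq.2 ⟨φ, fun i => add_sub_cancel_right (i : Fin 4) 1⟩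

/-- The cycle of order four can be rotated. -/
theorem bare_quad_rotate (a b c d : FramedClass Unit) :
    (quad a b c d).bare = (quad b c d a).bare := by
  rw [← bare_reframe (quad a b c d) (· + 1)]
  congr 1
  have h1 := reframe_attach (((square.cls.attach 0 a).attach 1 b).attach 2 c) (· + 1) (2 : Fin 4) d
  have h2 := reframe_attach ((square.cls.attach 0 a).attach 1 b) (· + 1) (1 : Fin 4) c
  have h3 := reframe_attach (square.cls.attach 0 a) (· + 1) (0 : Fin 4) b
  have h4 := reframe_attach square.cls (· + 1) (3 : Fin 4) a
  rw [square_reframe] at h4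
  refine h1.trans ?_
  rw [show (1 : Fin 4) + 1 = 2 from rfl] at h2
  rw [show (0 : Fin 4) + 1 = 1 from rfl] at h3
  rw [show (3 : Fin 4) + 1 = 0 from rfl] at h4
  rw [h2, h3, h4, quad, attach_comm _ 3 0, attach_comm _ 3 1, attach_comm _ 3 2]

theorem TreeClass.pos_quad {a} (h : TreeClass a) : Pos ((1 + 2 * X) * a.Q + a.R) := by
  have : Pos (1 + 2 * X : ℝ[X]) := pos_map (1 + 2 * X) (by simp) (by norm_num)
  exact (this.mul h.pos_Q).add h.R_mem

/-- Trees attached to opposite vertices of the cycle can be merged. -/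
theorem improvable_of_opposite {a b c d : FramedClass Unit} (ha : TreeClass a) (hb : TreeClass b)
    (hc : TreeClass c) (hd : TreeClass d) (ha1 : a ≠ 1) (hc1 : c ≠ 1) :
    Improvable (order a + order b + order c + order d) (leaves a + leaves b + leaves c + leaves d)
      (quad a b c d).bare := by
  refine ⟨_, ⟨a * c, b, 1, d, .mul ha hc, hb, .one, hd, rfl, ?_, ?_⟩, ?_⟩
  · have := order_mul a c
    rw [order_one]
    omega
  · rw [leaves_mul, leaves_one]
    omega
  · have : P (quad a b c d).bare - P (quad (a * c) b 1 d).bare =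
        a.R * c.R * (((1 + 2 * X) * b.Q + b.R) * ((1 + 2 * X) * d.Q + d.R)) := by
      rw [bare, bare, P_reframe, P_reframe, P_quad, P_quad, Q_mul, R_mul, Q_one, R_one]
      ring
    rw [this]
    exact ((ha.pos_R ha1).mul (hc.pos_R hc1)).mul (hb.pos_quad.mul hd.pos_quad)

/-- If two adjacent vertices of the cycle are the only ones with a tree attached, the trees can be
merged. -/
theorem improvable_of_adjacent {a b : FramedClass Unit} (ha : TreeClass a) (hb : TreeClass b)
    (ha1 : a ≠ 1) (hb1 : b ≠ 1) :
    Improvable (order a + order b + 2) (leaves a + leaves b) (quad a b 1 1).bare := by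
  refine ⟨_, ⟨a * b, 1, 1, 1, .mul ha hb, .one, .one, .one, rfl, ?_, ?_⟩, ?_⟩
  · have := order_mul a b
    rw [order_one]
    omega
  · rw [leaves_mul, leaves_one]; rfl
  · have : P (quad a b 1 1).bare - P (quad (a * b) 1 1 1).bare =
        a.R * b.R * (1 + 4 * X + 3 * X ^ 2) := by
      rw [bare, bare, P_reframe, P_reframe, P_quad, P_quad, Q_mul, R_mul, Q_one, R_one]
      ring
    rw [this]
    exact ((ha.pos_R ha1).mul (hb.pos_R hb1)).mul
      (pos_map (1 + 4 * X + 3 * X ^ 2) (by simp) (by norm_num))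

/-- A graph that cannot be improved is a cycle with a single attached tree. -/
theorem exists_eq_squareRoot_mul {n l : ℕ} {g : FramedClass Empty} (hg : g ∈ squareGraphs n l)
    (h : ¬ Improvable n l g) :
    ∃ t, TreeClass t ∧ order t + 3 = n ∧ leaves t = l ∧ g = (squareRoot * t).bare := by
  have one : ∀ t, (quad t 1 1 1).bare = (squareRoot * t).bare := fun t => by
    rw [squareRoot_mul, bare_reframe]
  have two : ∀ a b, TreeClass a → TreeClass b → g = (quad a b 1 1).bare →
      order a + order b + 2 = n → leaves a + leaves b = l →
      ∃ t, TreeClass t ∧ order t + 3 = n ∧ leaves t = l ∧ g = (squareRoot * t).bare := by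
    rintro a b ha hb rfl rfl rfl
    by_cases ha1 : a = 1
    · subst ha1
      refine ⟨b, hb, ?_, ?_, by rw [bare_quad_rotate, one]⟩
      · rw [order_one]; omega
      · rw [leaves_one]; omega
    · by_cases hb1 : b = 1
      · subst hb1
        refine ⟨a, ha, ?_, ?_, one a⟩
        · rw [order_one]
        · rw [leaves_one]; omega
      · exact (h (improvable_of_adjacent ha hb ha1 hb1)).elim
  obtain ⟨a, b, c, d, ha, hb, hc, hd, rfl, rfl, rfl⟩ := hg
  by_cases hac : a ≠ 1 ∧ c ≠ 1
  · exact (h (improvable_of_opposite ha hb hc hd hac.1 hac.2)).elim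
  by_cases hbd : b ≠ 1 ∧ d ≠ 1
  · refine (h ?_).elim
    have := improvable_of_opposite hb hc hd ha hbd.1 hbd.2
    rw [← bare_quad_rotate] at this
    convert this using 1 <;> omega
  have h1 : a = 1 ∨ c = 1 := by tauto
  have h2 : b = 1 ∨ d = 1 := by tauto
  have o := order_one
  have o' := leaves_one
  rcases h1 with rfl | rfl <;> rcases h2 with rfl | rfl
  · exact two c d hc hd (by rw [bare_quad_rotate, bare_quad_rotate]) (by omega) (by omega)
  · exact two b c hb hc (by rw [bare_quad_rotate]) (by omega) (by omega)
  · exact two d a hd ha (by rw [bare_quad_rotate, bare_quad_rotate, bare_quad_rotate]) (by omega)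
      (by omega)
  · exact two a b ha hb rfl (by omega) (by omega)

theorem squareRoot_mul_mem {t : FramedClass Unit} (ht : TreeClass t) :
    (squareRoot * t).bare ∈ squareGraphs (order t + 3) (leaves t) := by
  refine ⟨t, 1, 1, 1, ht, .one, .one, .one, by rw [squareRoot_mul, bare_reframe], ?_, ?_⟩
  · rw [order_one]
  · rw [leaves_one]; rfl

theorem Reducible.improvable {t : FramedClass Unit} (h : Reducible t) :
    Improvable (order t + 3) (leaves t) (squareRoot * t).bare := by
  obtain ⟨t', ht', h1, h2, h3, h4, h5⟩ := h
  refine ⟨_, h1 ▸ h2 ▸ squareRoot_mul_mem ht', ?_⟩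
  have : P (squareRoot * t).bare - P (squareRoot * t').bare =
      R squareRoot * (t.Q - t'.Q) + Q squareRoot * (t.P - t'.P) := by
    rw [bare, bare, P_reframe, P_reframe, P_mul, P_mul]
    simp only [P_eq]
    ring
  rw [this]
  by_cases h0 : t.Q - t'.Q = 0
  · rw [h0, mul_zero, zero_add]
    exact pos_Q_squareRoot.mul ⟨h4, fun h => h5 ⟨h0, h⟩⟩
  · exact (pos_R_squareRoot.mul ⟨h3, h0⟩).add (mul_mem pos_Q_squareRoot.1 h4)

/-- A graph that cannot be improved consists of the cycle, a path and a balanced bouquet whose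
legs are longer than the path by at least three edges. -/
theorem exists_eq_bouquet {n l : ℕ} {g : FramedClass Empty} (hg : g ∈ squareGraphs n l)
    (h : ¬ Improvable n l g) : ∃ (i : ℕ) (s : Multiset ℕ), (∀ k ∈ s, 1 ≤ k) ∧
      (∀ j ∈ s, ∀ k ∈ s, j ≤ k + 1) ∧ (0 < i → 2 ≤ Multiset.card s ∧ ∀ k ∈ s, i + 3 ≤ k) ∧
      s.sum + i + 4 = n ∧ Multiset.card s = l ∧
      g = (squareRoot * ext^[i] (bouquet s)).bare := by
  obtain ⟨t, ht, rfl, rfl, rfl⟩ := exists_eq_squareRoot_mul hg h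
  have hr : ¬ Reducible t := fun hr => h hr.improvable
  obtain ⟨i, s, hs, hi, rfl⟩ := ht.exists_bouquet hr
  have hl : leaves (ext^[i] (bouquet s)) = Multiset.card s := by
    rcases Nat.eq_zero_or_pos i with rfl | hi0
    · exact (leaves_bouquet hs).1
    · rw [(leaves_iterate (by rw [(leaves_bouquet hs).2]; have := hi hi0; omega) i).1,
        (leaves_bouquet hs).1]
  have ho : order (ext^[i] (bouquet s)) = s.sum + 1 + i := by
    rw [order_iterate, order_bouquet]
  refine ⟨i, s, hs, fun j hj k hk => ?_, fun hi0 => ⟨hi hi0, fun k hk => ?_⟩, by omega, hl.symm,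
    rfl⟩
  · by_contra hlt
    exact hr ((reducible_bouquet hs hj hk (by omega)).iterate (treeClass_bouquet s) i)
  · by_contra hlt
    obtain ⟨i, rfl⟩ : ∃ j, i = j + 1 := ⟨i - 1, by omega⟩
    obtain ⟨s, rfl⟩ := Multiset.exists_cons_of_mem hk
    have hs' : ∀ j ∈ s, 1 ≤ j := fun j hj => hs j (Multiset.mem_cons_of_mem hj)
    have hc := hi hi0
    rw [Multiset.card_cons] at hc
    have hne := bouquet_ne_one hs' (by omega)
    have hs2 : ∀ j ∈ (k + 1) ::ₘ s, 1 ≤ j := by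
      intro j hj
      rcases Multiset.mem_cons.1 hj with rfl | hj
      exacts [by omega, hs' j hj]
    refine h ⟨(squareRoot * ext^[i] (bouquet ((k + 1) ::ₘ s))).bare, ?_, ?_⟩
    · have h1 := squareRoot_mul_mem ((treeClass_bouquet ((k + 1) ::ₘ s)).iterate i)
      rw [order_iterate, order_bouquet, (leaves_iterate (by
        rw [(leaves_bouquet hs2).2, Multiset.card_cons]; omega) i).1, (leaves_bouquet hs2).1] at h1
      rw [hl, ho]
      simp only [Multiset.sum_cons, Multiset.card_cons] at h1 ⊢
      convert h1 using 2
      omega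
    · rw [bare, bare, P_reframe, P_reframe, bouquet_cons, bouquet_cons, path_succ, P_sub_P]
      exact ((treeClass_bouquet s).pos_R hne).mul (pos_D_iterate_squareRoot (by omega))

end FramedClass

/-! ### The balanced starlike unicyclic graphs as framed classes -/

/-- A path with an edge glued to its initial vertex. -/
noncomputable def gluePathIso (i : ℕ) :
    glue (⊤ : SimpleGraph (Fin 2)) 1 (pathGraph (i + 1)) 0 ≃g pathGraph (i + 2) where
  toEquiv := Equiv.ofBijective
    (fun x : GlueVertex (Fin 2) (0 : Fin (i + 1)) => match x with
      | .inl a => a.castLE (by omega)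
      | .inr x => x.1.succ)
    ((Fintype.bijective_iff_injective_and_card _).2 ⟨by
      rintro (a | ⟨x, hx⟩) (b | ⟨y, hy⟩) h
      · exact congrArg _ (Fin.castLE_injective _ h)
      · have := congrArg Fin.val h
        simp only [Fin.val_castLE, Fin.val_succ] at this
        have := Fin.pos_iff_ne_zero.2 hy
        rw [Fin.lt_def, Fin.val_zero] at this
        omega
      · have := congrArg Fin.val h
        simp only [Fin.val_castLE, Fin.val_succ] at this
        have := Fin.pos_iff_ne_zero.2 hx
        rw [Fin.lt_def, Fin.val_zero] at this
        omega
      · have := Fin.succ_injective _ h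
        subst this
        rfl, by
      rw [Fintype.card_sum, Fintype.card_fin, Fintype.card_fin, Fintype.card_subtype_compl,
        Fintype.card_fin, Fintype.card_subtype_eq]
      omega⟩)
  map_rel_iff' := by
    have h2 : 2 ≤ i + 2 := by omega
    rintro (a | ⟨x, hx⟩) (b | ⟨y, hy⟩)
    · change (pathGraph (i + 2)).Adj (a.castLE h2) (b.castLE h2) ↔ a ≠ b
      rw [pathGraph_adj, Fin.val_castLE, Fin.val_castLE, Ne, Fin.ext_iff]
      omega
    · change (pathGraph (i + 2)).Adj (a.castLE h2) y.succ ↔ a = 1 ∧ (pathGraph (i + 1)).Adj 0 y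
      rw [pathGraph_adj, pathGraph_adj, Fin.val_castLE, Fin.val_succ, Fin.ext_iff, Fin.val_zero,
        Fin.val_one]
      have := Fin.val_ne_of_ne hy
      rw [Fin.val_zero] at this
      omega
    · change (pathGraph (i + 2)).Adj x.succ (b.castLE h2) ↔ b = 1 ∧ (pathGraph (i + 1)).Adj 0 x
      rw [pathGraph_adj, pathGraph_adj, Fin.val_castLE, Fin.val_succ, Fin.ext_iff, Fin.val_zero,
        Fin.val_one]
      have := Fin.val_ne_of_ne hx
      rw [Fin.val_zero] at this
      omega
    · change (pathGraph (i + 2)).Adj x.succ y.succ ↔ (pathGraph (i + 1)).Adj x y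
      rw [pathGraph_adj, pathGraph_adj, Fin.val_succ, Fin.val_succ]
      omega

open Classical in
/-- Gluing a rooted graph to the far end of a path with `i` edges is an `i`-fold extension. -/
theorem cls_glue_pathGraph (i : ℕ) (A : FramedGraph Unit) :
    (⟨_, glue (pathGraph (i + 1)) (Fin.last i) A.graph (A.pt ()), fun _ => .inl 0⟩ :
      FramedGraph Unit).cls = ext^[i] A.cls := by
  induction i with
  | zero =>
    have h1 : (⟨Fin 1, pathGraph 1, fun _ => 0⟩ : FramedGraph Unit).cls = 1 :=
      cls_eq.2 ⟨⟨⟨fun _ => (), fun _ => 0, fun x => (Subsingleton.elim (α := Fin 1) _ _),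
        fun _ => rfl⟩, fun {x y} => iff_of_false (fun h => h.elim) (fun h =>
          (pathGraph 1).irrefl ((Subsingleton.elim (α := Fin 1) x y) ▸ h))⟩, fun _ => rfl⟩
    have h2 := one_mul A.cls
    rw [← h1] at h2
    exact h2
  | succ i ih =>
    rw [Function.iterate_succ_apply', ← ih]
    refine cls_eq.2 ⟨((glueAssoc (⊤ : SimpleGraph (Fin 2)) 1 (pathGraph (i + 1)) 0 (Fin.last i)
      A.graph (A.pt ())).trans (glueCongr (gluePathIso i) Iso.refl ?_ rfl)).symm, fun _ => ?_⟩
    · unfold glueInr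
      split_ifs with h
      · have := congrArg Fin.val h
        rw [Fin.val_last, Fin.val_zero] at this
        subst this
        exact Fin.ext rfl
      · exact Fin.ext rfl
    · exact (RelIso.symm_apply_eq _).2 (congrArg Sum.inl (Fin.ext rfl))

open Classical in
theorem cls_pathGraph (k : ℕ) :
    (⟨Fin (k + 1), pathGraph (k + 1), fun _ => 0⟩ : FramedGraph Unit).cls = path k := by
  rw [path, one_def, ← cls_glue_pathGraph]
  exact (cls_eq.2 ⟨@glueUnit _ _ _ _ (inferInstanceAs (Subsingleton Unit)) _ _, fun _ => rfl⟩).symm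

/-- A starlike tree, with one leg cut off at the center. -/
noncomputable def starlikeIso {l : ℕ} (a : Fin (l + 1) → ℕ) :
    glue (pathGraph (a 0 + 1)) 0 (starlikeTree fun j => a (Fin.succ j)) none ≃g starlikeTree a where
  toEquiv := Equiv.ofBijective
    (fun x : GlueVertex (Fin (a 0 + 1)) (none : Option (Σ j : Fin l, Fin (a (Fin.succ j)))) =>
      match x with
      | .inl x => Fin.cases none (fun k => some ⟨0, k⟩) x
      | .inr ⟨x, _⟩ => x.map fun y => ⟨y.1.succ, y.2⟩)
    ⟨by
      rintro (x | ⟨x, hx⟩) (y | ⟨y, hy⟩) h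
      · induction x using Fin.cases <;> induction y using Fin.cases <;> simp_all
      · obtain ⟨⟨j, k⟩, rfl⟩ := Option.ne_none_iff_exists'.1 hy
        induction x using Fin.cases <;> simp at h
        exact ((Fin.succ_ne_zero _) h.1.symm).elim
      · obtain ⟨⟨j, k⟩, rfl⟩ := Option.ne_none_iff_exists'.1 hx
        induction y using Fin.cases <;> simp at h
      · obtain ⟨⟨j, k⟩, rfl⟩ := Option.ne_none_iff_exists'.1 hx
        obtain ⟨⟨j', k'⟩, rfl⟩ := Option.ne_none_iff_exists'.1 hy
        simp only [Option.map_some, Option.some.injEq, Sigma.mk.injEq, Fin.succ_inj] at h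
        obtain ⟨rfl, h⟩ := h
        cases h
        rfl, by
      rintro (_ | ⟨j, k⟩)
      · exact ⟨.inl 0, rfl⟩
      · induction j using Fin.cases with
        | zero => exact ⟨.inl k.succ, rfl⟩
        | succ j => exact ⟨.inr ⟨some ⟨j, k⟩, by simp⟩, rfl⟩⟩
  map_rel_iff' := by
    rintro (x | ⟨x, hx⟩) (y | ⟨y, hy⟩)
    · change (starlikeTree a).Adj (Fin.cases none (fun k => some ⟨0, k⟩) x)
        (Fin.cases none (fun k => some ⟨0, k⟩) y) ↔ (pathGraph (a 0 + 1)).Adj x y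
      rw [pathGraph_adj]
      induction x using Fin.cases <;> induction y using Fin.cases
      all_goals simp [starlikeTree, Fin.ext_iff]
      omega
    · obtain ⟨⟨j, k⟩, rfl⟩ := Option.ne_none_iff_exists'.1 hy
      change (starlikeTree a).Adj (Fin.cases none (fun k => some ⟨0, k⟩) x) (some ⟨j.succ, k⟩) ↔
        x = 0 ∧ (starlikeTree fun j => a (Fin.succ j)).Adj none (some ⟨j, k⟩)
      induction x using Fin.cases <;> simp [starlikeTree, Fin.ext_iff]
    · obtain ⟨⟨j, k⟩, rfl⟩ := Option.ne_none_iff_exists'.1 hx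
      change (starlikeTree a).Adj (some ⟨j.succ, k⟩) (Fin.cases none (fun k => some ⟨0, k⟩) y) ↔
        y = 0 ∧ (starlikeTree fun j => a (Fin.succ j)).Adj none (some ⟨j, k⟩)
      induction y using Fin.cases <;> simp [starlikeTree, Fin.ext_iff]
    · obtain ⟨⟨j, k⟩, rfl⟩ := Option.ne_none_iff_exists'.1 hx
      obtain ⟨⟨j', k'⟩, rfl⟩ := Option.ne_none_iff_exists'.1 hy
      change (starlikeTree a).Adj (some ⟨j.succ, k⟩) (some ⟨j'.succ, k'⟩) ↔
        (starlikeTree fun j => a (Fin.succ j)).Adj (some ⟨j, k⟩) (some ⟨j', k'⟩)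
      simp [starlikeTree]

theorem cls_starlikeTree : ∀ {l : ℕ} (a : Fin l → ℕ),
    (⟨_, starlikeTree a, fun _ => none⟩ : FramedGraph Unit).cls = ∏ j, path (a j)
  | 0, a => by
    rw [Finset.univ_eq_empty, Finset.prod_empty]
    have : Subsingleton (Option (Σ j : Fin 0, Fin (a j))) := ⟨by
      rintro (_ | ⟨j, -⟩) (_ | ⟨j', -⟩)
      exacts [rfl, j'.elim0, j.elim0, j.elim0]⟩
    exact cls_eq.2 ⟨⟨⟨fun _ => (), fun _ => none, fun x => Subsingleton.elim
      (α := Option (Σ j : Fin 0, Fin (a j))) _ _, fun _ => rfl⟩, fun {x y} => iff_of_false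
        (fun h => h.elim) (fun h => (starlikeTree a).irrefl ((Subsingleton.elim
          (α := Option (Σ j : Fin 0, Fin (a j))) x y) ▸ h))⟩, fun _ => rfl⟩
  | l + 1, a => by
    rw [Fin.prod_univ_succ, ← cls_starlikeTree fun j => a (Fin.succ j), ← cls_pathGraph]
    exact (cls_eq.2 ⟨starlikeIso a, fun _ => rfl⟩).symm

namespace FramedClass

/-- The lengths of the legs of the balanced starlike tree with `m` edges. -/
def legs (m l : ℕ) : Multiset ℕ := Finset.univ.val.map (balancedLength (m + 1) l)

theorem bouquet_legs (m l : ℕ) : bouquet (legs m l) = ∏ j, path (balancedLength (m + 1) l j) := by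
  rw [bouquet, legs, Multiset.map_map]
  rfl

theorem card_legs (m l : ℕ) : Multiset.card (legs m l) = l := by
  rw [legs, Multiset.card_map]
  exact Fintype.card_fin l

theorem sum_legs {m l : ℕ} (hl : 1 ≤ l) : (legs m l).sum = m := by
  have h1 : (legs m l).sum = ∑ j : Fin l, (m / l + if j.val < m % l then 1 else 0) := rfl
  have h2 : ∑ j : Fin l, (if j.val < m % l then 1 else 0) = m % l := by
    rw [Fin.sum_univ_eq_sum_range fun j => if j < m % l then 1 else 0, Finset.sum_boole]
    have : (Finset.range l).filter (· < m % l) = Finset.range (m % l) := by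
      ext j
      have := Nat.mod_lt m hl
      simp only [Finset.mem_filter, Finset.mem_range]
      omega
    rw [this, Finset.card_range]
    rfl
  rw [h1, Finset.sum_add_distrib, h2, Finset.sum_const, Finset.card_univ, Fintype.card_fin,
    smul_eq_mul, Nat.div_add_mod]

theorem mem_legs {m l k : ℕ} (hk : k ∈ legs m l) : m / l ≤ k ∧ k ≤ m / l + 1 := by
  obtain ⟨j, -, rfl⟩ := Multiset.mem_map.1 hk
  rw [balancedLength, Nat.add_sub_cancel]
  split_ifs <;> omega

/-- A multiset whose elements differ by at most one is determined by its size and its sum. -/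
theorem eq_replicate_of_balanced {s : Multiset ℕ} {l : ℕ} (hl : 1 ≤ l)
    (hs : ∀ j ∈ s, ∀ k ∈ s, j ≤ k + 1) (hc : Multiset.card s = l) :
    s = Multiset.replicate (l - s.sum % l) (s.sum / l) +
      Multiset.replicate (s.sum % l) (s.sum / l + 1) := by
  have hex : ∃ k, k ∈ s := Multiset.card_pos_iff_exists_mem.1 (by omega)
  classical
  obtain ⟨k, hk, hmin⟩ : ∃ k ∈ s, ∀ j ∈ s, k ≤ j :=
    ⟨Nat.find hex, Nat.find_spec hex, fun j hj => Nat.find_min' hex hj⟩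
  have h1 := Multiset.filter_add_not (· = k) s
  have h2 : s.filter (¬ · = k) =
      Multiset.replicate (Multiset.card (s.filter (¬ · = k))) (k + 1) := by
    refine Multiset.eq_replicate.2 ⟨rfl, fun j hj => ?_⟩
    obtain ⟨hj, hne⟩ := Multiset.mem_filter.1 hj
    have := hs j hj k hk
    have := hmin j hj
    omega
  rw [h2, Multiset.filter_eq'] at h1
  generalize Multiset.card (s.filter (¬ · = k)) = c at h1
  have hpos := Multiset.count_pos.2 hk
  generalize s.count k = d at h1 hpos
  subst h1
  rw [Multiset.card_add, Multiset.card_replicate, Multiset.card_replicate] at hc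
  have hsum : (Multiset.replicate d k + Multiset.replicate c (k + 1)).sum = c + l * k := by
    rw [Multiset.sum_add, Multiset.sum_replicate, Multiset.sum_replicate, ← hc]
    simp only [smul_eq_mul]
    ring
  rw [hsum, Nat.add_mul_mod_self_left, Nat.add_mul_div_left _ _ hl, Nat.mod_eq_of_lt (by omega),
    Nat.div_eq_of_lt (by omega), zero_add, show l - c = d by omega]

theorem eq_legs {s : Multiset ℕ} {l : ℕ} (hl : 1 ≤ l) (hs : ∀ j ∈ s, ∀ k ∈ s, j ≤ k + 1)
    (hc : Multiset.card s = l) : s = legs s.sum l := by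
  rw [eq_replicate_of_balanced hl (fun j hj k hk => ?_) (card_legs s.sum l), sum_legs hl]
  · exact eq_replicate_of_balanced hl hs hc
  · have := mem_legs hj
    have := mem_legs hk
    omega

/-- The isomorphism class of the balanced starlike unicyclic graph with a path of `i` edges and
`m` edges in the starlike tree. -/
noncomputable def starlike (l m i : ℕ) : FramedClass Empty :=
  (squareRoot * ext^[i] (bouquet (legs m l))).bare

end FramedClass

open Classical in
theorem ofGraph_U (n l i : ℕ) : ofGraph (U n l 4 i) = starlike l (n - i - 4) i := by
  have h := cls_glue_pathGraph i ⟨_, BST (n - i - 4 + 1) l, fun _ => none⟩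
  have h2 : (⟨_, BST (n - i - 4 + 1) l, fun _ => none⟩ : FramedGraph Unit).cls =
      bouquet (legs (n - i - 4) l) := by
    rw [bouquet_legs]
    exact cls_starlikeTree _
  rw [h2] at h
  rw [starlike, ← h]
  refine Eq.trans ?_ (bare_cls (FramedGraph.attach ⟨Fin 4, cycleGraph 4, fun _ => 0⟩ () _)).symm
  refine ofGraph_eq_iff.2 ⟨((glueAssoc _ _ _ _ _ _ _).trans
    (glueCongr Iso.refl Iso.refl ?_ rfl)).symm⟩
  unfold glueInr
  split_ifs <;> rfl

/-! ### Laplacian coefficients and the polynomial `det (1 + t L)` -/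

theorem laplacianCoeff_eq {V : Type} [Fintype V] (G : SimpleGraph V) {k : ℕ}
    (hk : k ≤ Fintype.card V) : laplacianCoeff G k = (P (ofGraph G)).coeff k := by
  classical
  rw [P_ofGraph, detLap_eq, coeff_det_lapPoly G hk]

theorem coeff_P_eq_zero {V : Type} [Fintype V] (G : SimpleGraph V) {k : ℕ}
    (hk : Fintype.card V < k) : (P (ofGraph G)).coeff k = 0 := by
  classical
  rw [P_ofGraph, detLap_eq]
  exact coeff_eq_zero_of_natDegree_lt ((natDegree_det_lapPoly G).trans_lt hk)

theorem lapLE_iff {V W : Type} [Fintype V] [Fintype W] {G : SimpleGraph V} {H : SimpleGraph W} :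
    LapLE G H ↔ Fintype.card V = Fintype.card W ∧ P (ofGraph H) - P (ofGraph G) ∈ cone := by
  refine and_congr_right fun hc => ⟨fun h k => ?_, fun h k hk => ?_⟩
  · rw [coeff_sub, sub_nonneg]
    rcases le_or_gt k (Fintype.card V) with hk | hk
    · rw [← laplacianCoeff_eq G hk, ← laplacianCoeff_eq H (hc ▸ hk)]
      exact h k hk
    · rw [coeff_P_eq_zero G hk, coeff_P_eq_zero H (hc ▸ hk)]
  · rw [laplacianCoeff_eq G hk, laplacianCoeff_eq H (hc ▸ hk), ← sub_nonneg, ← coeff_sub]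
    exact h k

theorem lapLT_iff {V W : Type} [Fintype V] [Fintype W] {G : SimpleGraph V} {H : SimpleGraph W} :
    LapLT G H ↔ Fintype.card V = Fintype.card W ∧ Pos (P (ofGraph H) - P (ofGraph G)) := by
  rw [LapLT, lapLE_iff, and_assoc]
  refine and_congr_right fun hc => and_congr_right fun h => ⟨?_, fun hne => ?_⟩
  · rintro ⟨k, hk, hlt⟩ h0
    rw [laplacianCoeff_eq G hk, laplacianCoeff_eq H (hc ▸ hk), sub_eq_zero.1 h0] at hlt
    exact hlt.false
  · by_contra! hle
    refine hne (Polynomial.ext fun k => le_antisymm ?_ (h k))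
    rw [coeff_sub, coeff_zero, sub_nonpos]
    rcases le_or_gt k (Fintype.card V) with hk | hk
    · rw [← laplacianCoeff_eq G hk, ← laplacianCoeff_eq H (hc ▸ hk)]
      exact hle k hk
    · rw [coeff_P_eq_zero G hk, coeff_P_eq_zero H (hc ▸ hk)]

theorem order_bare {I : Type} (c : FramedClass I) : order c.bare = order c := by
  induction c using ind with | _ F
  rfl

theorem mem_unicyclicGraphs_iff_ofGraph {n l : ℕ} (G : SimpleGraph (Fin n)) :
    G ∈ unicyclicGraphs n l 4 ↔ ofGraph G ∈ squareGraphs n l := by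
  rw [mem_unicyclicGraphs_iff]
  constructor
  · rintro ⟨a, b, c, d, ha, hb, hc, hd, h, hl⟩
    refine ⟨a, b, c, d, ha, hb, hc, hd, h, ?_, hl⟩
    rw [← order_quad, ← order_bare, ← h]
    exact Fintype.card_fin n
  · rintro ⟨a, b, c, d, ha, hb, hc, hd, h, -, hl⟩
    exact ⟨a, b, c, d, ha, hb, hc, hd, h, hl⟩

/-- Every member of the family is realized on the vertex set `Fin n`. -/
theorem exists_ofGraph_eq {n l : ℕ} {g : FramedClass Empty} (hg : g ∈ squareGraphs n l) :
    ∃ G : SimpleGraph (Fin n), ofGraph G = g := by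
  have ho : order g = n := by
    obtain ⟨a, b, c, d, -, -, -, -, rfl, h, -⟩ := hg
    rw [order_bare, order_quad, h]
  induction g using ind with | _ F
  have e : F.V ≃ Fin n := Fintype.equivFinOfCardEq ho
  exact ⟨F.graph.map e.toEmbedding, cls_eq.2
    ⟨(SimpleGraph.Iso.map e F.graph).symm, fun i => i.elim⟩⟩

theorem isMinimalElement_iff {n l : ℕ} (G : SimpleGraph (Fin n)) :
    IsMinimalElement (unicyclicGraphs n l 4) G ↔
      ofGraph G ∈ squareGraphs n l ∧ ¬ Improvable n l (ofGraph G) := by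
  rw [IsMinimalElement, mem_unicyclicGraphs_iff_ofGraph]
  refine and_congr_right fun _ => ⟨?_, ?_⟩
  · rintro h ⟨g', hg', hpos⟩
    obtain ⟨G', rfl⟩ := exists_ofGraph_eq hg'
    exact h G' ((mem_unicyclicGraphs_iff_ofGraph G').2 hg') (lapLT_iff.2 ⟨rfl, hpos⟩)
  · exact fun h H hH hlt =>
      h ⟨_, (mem_unicyclicGraphs_iff_ofGraph H).1 hH, (lapLT_iff.1 hlt).2⟩

/-- Below every graph that can be improved there is one that cannot, since there are only finitely
many graphs. -/
theorem FramedClass.Improvable.exists_minimal {n l : ℕ} {g : FramedClass Empty}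
    (h : Improvable n l g) :
    ∃ g' ∈ squareGraphs n l, ¬ Improvable n l g' ∧ Pos (P g - P g') := by
  obtain ⟨g₀, hg₀, h₀⟩ := h
  obtain ⟨G₀, rfl⟩ := exists_ofGraph_eq hg₀
  obtain ⟨G, ⟨hG, hpos⟩, hmin⟩ := Set.exists_min_image
    {G : SimpleGraph (Fin n) | ofGraph G ∈ squareGraphs n l ∧ Pos (P g - P (ofGraph G))}
    (fun G => (P (ofGraph G)).eval 1) (Set.toFinite _) ⟨G₀, hg₀, h₀⟩
  refine ⟨_, hG, ?_, hpos⟩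
  rintro ⟨g', hg', h'⟩
  obtain ⟨G', rfl⟩ := exists_ofGraph_eq hg'
  have h1 := hmin G' ⟨hg', by
    have := hpos.add h'.1
    rwa [sub_add_sub_cancel] at this⟩
  have h2 := h'.eval_pos one_pos
  rw [eval_sub] at h2
  linarith

namespace FramedClass

/-! ### Comparison of the candidates -/

theorem starlike_mem {l m : ℕ} (hl : 1 ≤ l) (hm : l ≤ m) (i : ℕ) :
    starlike l m i ∈ squareGraphs (m + i + 4) l := by
  have hs : ∀ k ∈ legs m l, 1 ≤ k :=
    fun k hk => ((Nat.one_le_div_iff hl).2 hm).trans (mem_legs hk).1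
  have h := squareRoot_mul_mem ((treeClass_bouquet (legs m l)).iterate i)
  rw [(leaves_iterate (by rw [(leaves_bouquet hs).2, card_legs]; exact hl) i).1,
    (leaves_bouquet hs).1, card_legs, order_iterate, order_bouquet, sum_legs hl] at h
  rwa [show m + 1 + i + 3 = m + i + 4 by omega] at h

/-- Lengthening the path at the cost of a shortest leg: the effect on `det (1 + t L)`. -/
theorem P_starlike_sub {l m : ℕ} (hl : 1 ≤ l) (hm : l ≤ m) (i : ℕ) :
    ∃ r : ℝ[X], (l = 1 → r = 0) ∧ (2 ≤ l → Pos r) ∧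
      P (starlike l m (i + 1)) - P (starlike l (m + 1) i) =
        r * D (ext^[i] squareRoot) (path (m / l)) := by
  have hmem : m / l ∈ legs m l := by
    refine Multiset.mem_map.2 ⟨⟨l - 1, by omega⟩, Finset.mem_univ_val _, ?_⟩
    have := Nat.mod_lt m hl
    rw [balancedLength, Nat.add_sub_cancel, if_neg (not_lt.2 (Nat.le_sub_one_of_lt this)),
      add_zero]
  obtain ⟨s, hs⟩ := Multiset.exists_cons_of_mem hmem
  have hcard : Multiset.card s + 1 = l := by
    rw [← Multiset.card_cons (m / l), ← hs, card_legs]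
  have hsum : m / l + s.sum = m := by rw [← Multiset.sum_cons, ← hs, sum_legs hl]
  have hs1 : ∀ k ∈ s, m / l ≤ k ∧ k ≤ m / l + 1 :=
    fun k hk => mem_legs (hs ▸ Multiset.mem_cons_of_mem hk)
  have hs2 : (m / l + 1) ::ₘ s = legs (m + 1) l := by
    have := eq_legs (s := (m / l + 1) ::ₘ s) hl ?_ (by rw [Multiset.card_cons, hcard])
    · rwa [Multiset.sum_cons, show m / l + 1 + s.sum = m + 1 by omega] at this
    · intro j hj k hk
      have h1 : ∀ k ∈ (m / l + 1) ::ₘ s, m / l ≤ k ∧ k ≤ m / l + 1 := fun k hk => by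
        rcases Multiset.mem_cons.1 hk with rfl | hk
        exacts [by omega, hs1 k hk]
      have := h1 j hj
      have := h1 k hk
      omega
  refine ⟨R (bouquet s), fun h1 => ?_, fun h2 => ?_, ?_⟩
  · rw [Multiset.card_eq_zero.1 (show Multiset.card s = 0 by omega), bouquet_zero, R_one]
  · exact (treeClass_bouquet s).pos_R (bouquet_ne_one
      (fun k hk => ((Nat.one_le_div_iff hl).2 hm).trans (hs1 k hk).1) (by omega))
  · rw [starlike, starlike, bare, bare, P_reframe, P_reframe, hs, ← hs2, bouquet_cons, bouquet_cons,
      path_succ, P_sub_P]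

/-- At a small argument the rooted square is heavier than all paths: the quotient `R / Q` is at most
`1 / 10` at `t = 1 / 10` for every path. -/
theorem D_squareRoot_path_eval_pos (k : ℕ) : 0 < (D squareRoot (path k)).eval (1 / 10) := by
  have h : (R (path k)).eval (1 / 10) ≤ 1 / 10 * (Q (path k)).eval (1 / 10) := by
    induction k with
    | zero => rw [path_zero, Q_one, R_one]; norm_num
    | succ k ih =>
      have := (treeClass_path k).pos_Q.eval_pos (t := 1 / 10) (by norm_num)
      rw [Q_path_succ, R_path_succ]
      simp only [eval_mul, eval_add, eval_X, eval_one]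
      linarith
  have := (treeClass_path k).pos_Q.eval_pos (t := 1 / 10) (by norm_num)
  rw [D, Q_squareRoot, R_squareRoot]
  simp only [eval_mul, eval_add, eval_sub, eval_X, eval_one, eval_pow, eval_ofNat]
  linarith

/-- At a large argument the rooted square is lighter than the paths with at least four edges. As
longer paths are heavier, it suffices to look at four edges, where the leading term of the
difference is `-4 t ^ 7`. -/
theorem D_squareRoot_path_eval_neg {k : ℕ} (hk : 4 ≤ k) :
    (D squareRoot (path k)).eval 100 < 0 := by
  have h4 : (D squareRoot (path 4)).eval 100 < 0 := by
    simp [D, Q_path_succ, R_path_succ, path_zero, Q_one, R_one, Q_squareRoot, R_squareRoot]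
    norm_num
  obtain ⟨m, rfl⟩ := Nat.exists_eq_add_of_le' hk
  have h : Q (path 4) * D squareRoot (path (m + 4)) = Q (path (m + 4)) * D squareRoot (path 4) -
      Q squareRoot * D (path (m + 4)) (path 4) := by
    simp only [D]; ring
  have h1 := congrArg (eval 100) h
  rw [D_path_path, eval_sub, eval_mul, eval_mul, eval_mul] at h1
  have h2 := (treeClass_path 4).pos_Q.eval_pos (t := 100) (by norm_num)
  have h3 := (treeClass_path (m + 4)).pos_Q.eval_pos (t := 100) (by norm_num)
  have h5 := eval_nonneg_of_mem_cone (mul_mem pos_Q_squareRoot.1 (mul_mem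
    (pow_mem X_mem_cone (2 * 4)) (treeClass_path m).R_mem)) (t := 100) (by norm_num)
  rw [eval_mul] at h5
  have h6 := mul_neg_of_pos_of_neg h3 h4
  by_contra! h7
  have := mul_nonneg h2.le h7
  linarith

theorem D_iterate_squareRoot_path {i k : ℕ} (hk : i ≤ k) :
    D (ext^[i] squareRoot) (path k) = X ^ (2 * i) * D squareRoot (path (k - i)) := by
  obtain ⟨m, rfl⟩ := Nat.exists_eq_add_of_le hk
  rw [path_add, D_iterate_add, Nat.add_sub_cancel_left]

/-- The numbers `i` of edges of the path for which the starlike unicyclic graph is minimal: `i = 0`,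
or the `n - 4 - i` edges of the starlike tree suffice for `l` legs with at least `i + 3` edges. -/
def Admissible (n l i : ℕ) : Prop := i = 0 ∨ l * (i + 3) + 4 + i ≤ n

theorem Admissible.of_le {n l i j : ℕ} (h : Admissible n l j) (hij : i ≤ j) : Admissible n l i := by
  rcases Nat.eq_zero_or_pos i with h0 | h0
  · exact .inl h0
  · have h1 := h.resolve_left (by omega)
    have := Nat.mul_le_mul_left l (Nat.add_le_add_right hij 3)
    exact .inr (by omega)

theorem Admissible.le {n l i : ℕ} (hn : 4 + l ≤ n) (h : Admissible n l i) : l + i + 4 ≤ n := by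
  rcases h with rfl | h
  · omega
  · have := Nat.mul_le_mul_left l (show 1 ≤ i + 3 by omega)
    omega

theorem P_starlike_succ {n l i : ℕ} (hl : 1 ≤ l) (h : Admissible n l (i + 1)) :
    ∃ r : ℝ[X], (l = 1 → r = 0) ∧ (2 ≤ l → Pos r) ∧ ∃ k, 4 ≤ k ∧
      P (starlike l (n - (i + 1) - 4) (i + 1)) - P (starlike l (n - i - 4) i) =
        r * (X ^ (2 * i) * D squareRoot (path k)) := by
  have h1 := h.resolve_left (by omega)
  obtain ⟨m, rfl⟩ : ∃ m, n = m + i + 5 := ⟨n - i - 5, by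
    have := Nat.zero_le (l * (i + 1 + 3))
    omega⟩
  have h2 : l * (i + 4) ≤ m := by
    rw [show i + 1 + 3 = i + 4 by omega] at h1
    omega
  have h3 : i + 4 ≤ m / l := (Nat.le_div_iff_mul_le hl).2 (by rwa [mul_comm])
  obtain ⟨r, hr1, hr2, hr⟩ := P_starlike_sub (m := m) hl
    ((Nat.le_mul_of_pos_right l (by omega)).trans h2) i
  refine ⟨r, hr1, hr2, m / l - i, by omega, ?_⟩
  rw [← D_iterate_squareRoot_path (by omega), ← hr]
  congr 3 <;> omega

/-- For at least two leaves the values of `det (1 + t L)` at `t = 1 / 10` increase and those at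
`t = 100` decrease with the length of the path. -/
theorem eval_P_starlike {n l : ℕ} (hl : 2 ≤ l) {i j : ℕ} (hij : i < j) (hj : Admissible n l j) :
    (P (starlike l (n - i - 4) i)).eval (1 / 10) < (P (starlike l (n - j - 4) j)).eval (1 / 10) ∧
      (P (starlike l (n - j - 4) j)).eval 100 < (P (starlike l (n - i - 4) i)).eval 100 := by
  induction j with
  | zero => omega
  | succ j ih =>
    obtain ⟨r, -, hr, k, hk, h⟩ := P_starlike_succ (by omega) hj
    have h1 := congrArg (eval (1 / 10)) h
    have h2 := congrArg (eval 100) h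
    simp only [eval_sub, eval_mul, eval_pow, eval_X] at h1 h2
    have h3 := mul_pos ((hr hl).eval_pos (t := 1 / 10) (by norm_num)) (mul_pos
      (pow_pos (show (0 : ℝ) < 1 / 10 by norm_num) (2 * j)) (D_squareRoot_path_eval_pos k))
    have h4 := mul_neg_of_pos_of_neg ((hr hl).eval_pos (t := 100) (by norm_num))
      (mul_neg_of_pos_of_neg (pow_pos (show (0 : ℝ) < 100 by norm_num) (2 * j))
        (D_squareRoot_path_eval_neg hk))
    rcases Nat.lt_succ_iff_lt_or_eq.1 hij with hlt | rfl
    · obtain ⟨h5, h6⟩ := ih hlt (hj.of_le (Nat.le_succ j))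
      constructor <;> linarith
    · constructor <;> linarith

/-- For a single leaf all the candidates have the same Laplacian coefficients. -/
theorem P_starlike_one {n i : ℕ} (hi : Admissible n 1 i) :
    P (starlike 1 (n - i - 4) i) = P (starlike 1 (n - 4) 0) := by
  induction i with
  | zero => rfl
  | succ i ih =>
    obtain ⟨r, hr, -, k, -, h⟩ := P_starlike_succ le_rfl hi
    rw [hr rfl, zero_mul, sub_eq_zero] at h
    rw [h, ih (hi.of_le (Nat.le_succ i))]

/-- The candidates are pairwise incomparable. -/
theorem sub_notMem_cone {n l : ℕ} (hl : 2 ≤ l) {i j : ℕ} (hij : i ≠ j) (hi : Admissible n l i)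
    (hj : Admissible n l j) :
    P (starlike l (n - j - 4) j) - P (starlike l (n - i - 4) i) ∉ cone := by
  intro h
  rcases hij.lt_or_gt with hlt | hlt
  · have h1 := (eval_P_starlike hl hlt hj).2
    have h2 := eval_nonneg_of_mem_cone h (t := 100) (by norm_num)
    rw [eval_sub] at h2
    linarith
  · have h1 := (eval_P_starlike hl hlt hi).1
    have h2 := eval_nonneg_of_mem_cone h (t := 1 / 10) (by norm_num)
    rw [eval_sub] at h2
    linarith

theorem exists_admissible {n l : ℕ} (hl : 1 ≤ l) {g : FramedClass Empty}
    (hg : g ∈ squareGraphs n l) (h : ¬ Improvable n l g) :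
    ∃ i, Admissible n l i ∧ g = starlike l (n - i - 4) i := by
  obtain ⟨i, s, -, hs, hi, hsum, hcard, rfl⟩ := exists_eq_bouquet hg h
  refine ⟨i, ?_, ?_⟩
  · rcases Nat.eq_zero_or_pos i with h0 | h0
    · exact .inl h0
    · have := Multiset.card_nsmul_le_sum (hi h0).2
      rw [hcard, smul_eq_mul] at this
      exact .inr (by omega)
  · rw [starlike, show n - i - 4 = s.sum by omega, ← eq_legs hl hs hcard]

theorem not_improvable_starlike {n l i : ℕ} (hl : 1 ≤ l) (hi : Admissible n l i) :
    ¬ Improvable n l (starlike l (n - i - 4) i) := by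
  intro h
  obtain ⟨g, hg, h1, h2⟩ := h.exists_minimal
  obtain ⟨j, hj, rfl⟩ := exists_admissible hl hg h1
  rcases hl.eq_or_lt with rfl | hl2
  · rw [P_starlike_one hi, P_starlike_one hj, sub_self] at h2
    exact h2.2 rfl
  · by_cases hij : j = i
    · subst hij
      rw [sub_self] at h2
      exact h2.2 rfl
    · exact sub_notMem_cone hl2 hij hj hi h2.1

end FramedClass

theorem le_iff_admissible {n l p : ℕ}
    (hp : (p : ℤ) = max 0 ⌊((n : ℝ) - 4 - 3 * (l : ℝ)) / ((l : ℝ) + 1)⌋) (i : ℕ) :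
    i ≤ p ↔ Admissible n l i := by
  rw [← Int.ofNat_le, hp, le_max_iff, Int.le_floor, le_div_iff₀ (by positivity)]
  refine or_congr (by omega) ?_
  rw [← Nat.cast_le (α := ℝ)]
  push_cast
  constructor <;> intro h <;> linarith

end LaplacianPoset

open LaplacianPoset FramedClass in
theorem theorem4p6 (n l p : ℕ) (hl : 1 ≤ l) (hn : 4 + l ≤ n)
    (hp : (p : ℤ) = max 0 ⌊((n : ℝ) - 4 - 3 * (l : ℝ)) / ((l : ℝ) + 1)⌋) :
    (∀ G : SimpleGraph (Fin n),
      LaplacianPoset.IsMinimalElement (LaplacianPoset.unicyclicGraphs n l 4) G ↔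
        ∃ i ≤ p, Nonempty (G ≃g LaplacianPoset.U n l 4 i)) ∧
    (2 ≤ l → ∀ i ≤ p, ∀ j ≤ p, i ≠ j →
      ¬ Nonempty (LaplacianPoset.U n l 4 i ≃g LaplacianPoset.U n l 4 j) ∧
      ¬ LaplacianPoset.LapLE (LaplacianPoset.U n l 4 i) (LaplacianPoset.U n l 4 j)) := by
  refine ⟨fun G => ?_, fun hl2 i hi j hj hij => ?_⟩
  · rw [isMinimalElement_iff]
    simp only [← ofGraph_eq_iff, ofGraph_U]
    constructor
    · rintro ⟨hG, hmin⟩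
      obtain ⟨i, hi, h⟩ := exists_admissible hl hG hmin
      exact ⟨i, (le_iff_admissible hp i).2 hi, h⟩
    · rintro ⟨i, hi, h⟩
      have hi := (le_iff_admissible hp i).1 hi
      have hle := hi.le hn
      rw [h]
      refine ⟨?_, not_improvable_starlike hl hi⟩
      have := starlike_mem hl (show l ≤ n - i - 4 by omega) i
      rwa [show n - i - 4 + i + 4 = n by omega] at this
  · have hi := (le_iff_admissible hp i).1 hi
    have hj := (le_iff_admissible hp j).1 hj
    have h := sub_notMem_cone hl2 hij hi hj
    rw [← ofGraph_eq_iff, lapLE_iff, ofGraph_U, ofGraph_U]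
    refine ⟨fun he => h ?_, fun he => h he.2⟩
    rw [he, sub_self]
    exact zero_mem _
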